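/- Let $K=\mathbb Q(\sqrt2)$ with ring of integers $\mathcal O_K=\mathbb Z[\sqrt2]$, and let $\mathcal A=\left(\frac{-1,-1}{K}\right)=K\oplus K\mathbf i\oplus K\mathbf j\oplus K\mathbf k$ with $\mathbf i^2=\mathbf j^2=-1$, $\mathbf k=\mathbf i\mathbf j=-\mathbf j\mathbf i$, equipped with the reduced norm $\mathrm{nrd}(t+x\mathbf i+y\mathbf j+z\mathbf k)=t^2+x^2+y^2+z^2$. Inside the cubian order $$\mathbb K=\mathcal O_K\oplus\mathcal O_K\tfrac1{\sqrt2}(1+\mathbf i)\oplus\mathcal O_K\tfrac1{\sqrt2}(1+\mathbf j)\oplus\mathcal O_K\tfrac{1+\mathbf i+\mathbf j+\mathbf k}2$$ consider the order $$\mathcal G=\mathcal O_K\oplus\mathcal O_K\,2\sqrt2\,\mathbf i\oplus\mathcal O_K\Bigl(2\mathbf i+\tfrac{\mathbf i+\mathbf j}{\sqrt2}\Bigr)\oplus\mathcal O_K\,\tfrac{(1+\sqrt2)+(3+\sqrt2)\mathbf i+\mathbf j+\mathbf k}2 .$$ Let $\alpha\in\mathcal O_K$ be totally positive (that is, positive under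 both real embeddings of $K$), let $e\ge0$ be the integer with $\alpha\in(\sqrt2)^e\mathcal O_K$ and $\alpha\notin(\sqrt2)^{e+1}\mathcal O_K$, and let $r_{\mathcal G}(\alpha)=\#\{\mathbf q\in\mathcal G\mid \mathrm{nrd}(\mathbf q)=\alpha\}$. Then $r_{\mathcal G}(\alpha)$ is finite and $$r_{\mathcal G}(\alpha)=2\sum_{\sqrt2\mathcal O_K\,\nmid\,\delta\mathcal O_K\,\mid\,\alpha\mathcal O_K}\mathrm N(\delta\mathcal O_K)\cdot\begin{cases}1,&e=0,\\2\cdot2,&e=1,\\3\cdot2^2,&e=2,\\4\cdot2^3,&e=3,\\2(2^3+\cdots+2^e)+3\cdot2^e-2^3,&e\ge4,\end{cases}$$ where the sum runs over all ideals $\delta\mathcal O_K$ of $\mathcal O_K$ which divide $\alpha\mathcal O_K$ and are not divisible by $\sqrt2\mathcal O_K$, and $\mathrm N$ denotes the absolute norm of an ideal. -/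

import Mathlib

open scoped NumberField Quaternion IntermediateField

namespace SqrtTwoQuaternion

/-- The real quadratic field `K = ℚ(√2)`, realised as a subfield of `ℝ`. -/
def K : Type := ℚ⟮(√2 : ℝ)⟯

noncomputable instance instFieldK : Field K := inferInstanceAs (Field ℚ⟮(√2 : ℝ)⟯)

instance instNumberFieldK : NumberField K := by
  have h : IsIntegral ℚ (√2 : ℝ) :=
    ⟨Polynomial.X ^ 2 - Polynomial.C 2, Polynomial.monic_X_pow_sub_C 2 (by norm_num), by simp⟩
  have hn : NumberField ℚ⟮(√2 : ℝ)⟯ :=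
    { to_charZero := inferInstance
      to_finiteDimensional := IntermediateField.adjoin.finiteDimensional h }
  exact hn

/-- The element `√2` of `K`. -/
noncomputable def sqrtTwoK : K := ⟨√2, IntermediateField.mem_adjoin_simple_self ℚ (√2 : ℝ)⟩

theorem sqrtTwoK_sq : sqrtTwoK ^ 2 = 2 := by
  apply Subtype.ext
  change (√2 : ℝ) ^ 2 = 2
  simp

theorem inv_sqrtTwoK : sqrtTwoK⁻¹ = sqrtTwoK / 2 := by
  have hs := sqrtTwoK_sq
  have h0 : sqrtTwoK ≠ 0 := by rintro h; simp [h] at hs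
  field_simp
  exact hs.symm

/-- The element `√2` of the ring of integers `𝓞 K`. -/
noncomputable def sqrtTwo : 𝓞 K :=
  ⟨sqrtTwoK, Polynomial.X ^ 2 - Polynomial.C 2, Polynomial.monic_X_pow_sub_C 2 (by norm_num), by
    simp [sqrtTwoK_sq]⟩

theorem coe_sqrtTwo : (sqrtTwo : K) = sqrtTwoK := rfl

@[simp] theorem algebraMap_sqrtTwo : algebraMap (𝓞 K) K sqrtTwo = sqrtTwoK := rfl

/-- An integer of `K` is totally positive if it is positive under every real embedding of `K`. -/
def IsTotallyPositive (α : 𝓞 K) : Prop := ∀ σ : K →+* ℝ, 0 < σ (α : K)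

/-- The quaternion `t + x i + y j + z k` in the algebra `(-1, -1 / K)`. -/
def quat (t x y z : K) : ℍ[K] := ⟨t, x, y, z⟩

@[simp] theorem re_quat (t x y z : K) : (quat t x y z).re = t := rfl

@[simp] theorem imI_quat (t x y z : K) : (quat t x y z).imI = x := rfl

@[simp] theorem imJ_quat (t x y z : K) : (quat t x y z).imJ = y := rfl

@[simp] theorem imK_quat (t x y z : K) : (quat t x y z).imK = z := rfl

/-- The `𝓞 K`-basis
`1, (1 + i) / √2, (1 + j) / √2, (1 + i + j + k) / 2`
of the cubian order, written in coordinates with respect to `1, i, j, k`. -/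
noncomputable def cubianBasis : Fin 4 → ℍ[K] :=
  ![quat 1 0 0 0,
    quat (1 / sqrtTwoK) (1 / sqrtTwoK) 0 0,
    quat (1 / sqrtTwoK) 0 (1 / sqrtTwoK) 0,
    quat (1 / 2) (1 / 2) (1 / 2) (1 / 2)]

/-- The `𝓞 K`-basis
`1, 2√2 i, 2i + (i + j) / √2, ((1 + √2) + (3 + √2) i + j + k) / 2`
of the suborder `G`, written in coordinates with respect to `1, i, j, k`. -/
noncomputable def subBasis : Fin 4 → ℍ[K] :=
  ![quat 1 0 0 0,
    quat 0 (2 * sqrtTwoK) 0 0,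
    quat 0 (2 + 1 / sqrtTwoK) (1 / sqrtTwoK) 0,
    quat ((1 + sqrtTwoK) / 2) ((3 + sqrtTwoK) / 2) (1 / 2) (1 / 2)]

/-- The set of all `𝓞 K`-linear combinations `∑ i, c i • b i` of four quaternions `b i`. -/
def integralSpan (b : Fin 4 → ℍ[K]) : Set ℍ[K] :=
  {q | ∃ c : Fin 4 → 𝓞 K, q = ∑ i, (c i : K) • b i}

/-- If `b 0 = 1` and all products `b i * b j` are `𝓞 K`-linear combinations of the `b k`, then the
set of `𝓞 K`-linear combinations of the `b i` is a subring of the quaternion algebra. -/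
def spanSubring (b : Fin 4 → ℍ[K]) (h1 : b 0 = 1) (hb : ∀ i j, b i * b j ∈ integralSpan b) :
    Subring ℍ[K] where
  carrier := integralSpan b
  one_mem' := ⟨![1, 0, 0, 0], by simp [Fin.sum_univ_four, h1]⟩
  zero_mem' := ⟨0, by simp⟩
  add_mem' := by
    rintro _ _ ⟨c, rfl⟩ ⟨d, rfl⟩
    exact ⟨c + d, by simp [add_smul, Finset.sum_add_distrib]⟩
  neg_mem' := by
    rintro _ ⟨c, rfl⟩
    exact ⟨-c, by simp⟩
  mul_mem' := by
    rintro _ _ ⟨c, rfl⟩ ⟨d, rfl⟩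
    choose m hm using hb
    refine ⟨fun k => ∑ i, ∑ j, c i * d j * m i j k, ?_⟩
    simp only [Finset.sum_mul, Finset.mul_sum, smul_mul_smul_comm, hm, map_sum, map_mul,
      Finset.sum_smul, Finset.smul_sum, smul_smul]
    conv_rhs => rw [Finset.sum_comm]
    rw [Finset.sum_comm]
    exact Finset.sum_congr rfl fun i _ => Finset.sum_comm

theorem cubianBasis_mul (i j : Fin 4) : cubianBasis i * cubianBasis j ∈ integralSpan cubianBasis := by
  have hs := sqrtTwoK_sq
  refine ⟨![
    ![![1, 0, 0, 0],
      ![0, 1, 0, 0],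
      ![0, 0, 1, 0],
      ![0, 0, 0, 1]],
    ![![0, 1, 0, 0],
      ![-1, sqrtTwo, 0, 0],
      ![0, 0, 0, 1],
      ![0, 0, -1, sqrtTwo]],
    ![![0, 0, 1, 0],
      ![-1, sqrtTwo, sqrtTwo, -1],
      ![-1, 0, sqrtTwo, 0],
      ![-sqrtTwo, 1, 1, 0]],
    ![![0, 0, 0, 1],
      ![-sqrtTwo, 1, 1, 0],
      ![0, -1, 0, sqrtTwo],
      ![-1, 0, 0, 1]]
    ] i j, ?_⟩
  fin_cases i <;> fin_cases j <;> ext <;>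
    simp [cubianBasis, Fin.sum_univ_four, Algebra.smul_def, inv_sqrtTwoK] <;> grind

theorem subBasis_mul (i j : Fin 4) : subBasis i * subBasis j ∈ integralSpan subBasis := by
  have hs := sqrtTwoK_sq
  have h2 : algebraMap (𝓞 K) K 2 = 2 := map_ofNat _ 2
  have h3 : algebraMap (𝓞 K) K 3 = 3 := map_ofNat _ 3
  have h4 : algebraMap (𝓞 K) K 4 = 4 := map_ofNat _ 4
  have h5 : algebraMap (𝓞 K) K 5 = 5 := map_ofNat _ 5
  have h6 : algebraMap (𝓞 K) K 6 = 6 := map_ofNat _ 6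
  have h8 : algebraMap (𝓞 K) K 8 = 8 := map_ofNat _ 8
  refine ⟨![
    ![![1, 0, 0, 0],
      ![0, 1, 0, 0],
      ![0, 0, 1, 0],
      ![0, 0, 0, 1]],
    ![![0, 1, 0, 0],
      ![-8, 0, 0, 0],
      ![-4 - 6 * sqrtTwo, 1 - sqrtTwo, -2 * sqrtTwo, 4],
      ![-4 - 4 * sqrtTwo, 2 * sqrtTwo, -4, 2 * sqrtTwo]],
    ![![0, 0, 1, 0],
      ![-2 * sqrtTwo, -1 + sqrtTwo, 2 * sqrtTwo, -4],
      ![-5 - 2 * sqrtTwo, 0, 0, 0],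
      ![-3 - 2 * sqrtTwo, 2, 1 - sqrtTwo, 1 - sqrtTwo]],
    ![![0, 0, 0, 1],
      ![-2 * sqrtTwo, 1 - sqrtTwo, 4, -2 * sqrtTwo],
      ![-4 - 2 * sqrtTwo, -2, 2 * sqrtTwo, -1 + sqrtTwo],
      ![-4 - 2 * sqrtTwo, 0, 0, 1 + sqrtTwo]]
    ] i j, ?_⟩
  fin_cases i <;> fin_cases j <;> ext <;>
    simp [subBasis, Fin.sum_univ_four, Algebra.smul_def, inv_sqrtTwoK] <;> grind

/-- The cubian order in the quaternion algebra `(-1, -1 / K)`. -/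
noncomputable def cubianOrder : Subring ℍ[K] :=
  spanSubring cubianBasis (by ext <;> simp [cubianBasis]) cubianBasis_mul

/-- The order `G` (of index `(√2)⁴` in the cubian order). -/
noncomputable def orderG : Subring ℍ[K] :=
  spanSubring subBasis (by ext <;> simp [subBasis]) subBasis_mul

theorem orderG_le_cubianOrder : orderG ≤ cubianOrder := by
  have hs := sqrtTwoK_sq
  have h2 : algebraMap (𝓞 K) K 2 = 2 := map_ofNat _ 2
  have h4 : algebraMap (𝓞 K) K 4 = 4 := map_ofNat _ 4
  rintro _ ⟨c, rfl⟩
  refine ⟨![c 0 - 2 * sqrtTwo * c 1 - (2 + sqrtTwo) * c 2 - c 3,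
    4 * c 1 + (1 + 2 * sqrtTwo) * c 2 + (1 + sqrtTwo) * c 3, c 2, c 3], ?_⟩
  ext <;> simp [subBasis, cubianBasis, Fin.sum_univ_four, Algebra.smul_def, inv_sqrtTwoK] <;> grind

/-- The number (possibly infinite) of elements of reduced norm `α` in a subring of the quaternion
algebra `(-1, -1 / K)`. -/
noncomputable def repCount (G : Subring ℍ[K]) (α : 𝓞 K) : ℕ∞ :=
  Set.encard {q : ℍ[K] | q ∈ G ∧ Quaternion.normSq q = (α : K)}

/-- The sum of the norms of all ideals of `𝓞 K` that divide `α` and are not divisible by `√2`. -/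
noncomputable def oddDivisorSum (α : 𝓞 K) : ℕ :=
  ∑ᶠ I ∈ {I : Ideal (𝓞 K) | ¬ Ideal.span {sqrtTwo} ∣ I ∧ I ∣ Ideal.span {α}}, Ideal.absNorm I

/-- The factor depending on the `√2`-adic valuation `e`. -/
def valuationFactor : ℕ → ℕ
  | 0 => 1
  | 1 => 2 * 2
  | 2 => 3 * 2 ^ 2
  | 3 => 4 * 2 ^ 3
  | e => 2 * ∑ i ∈ Finset.Icc 3 e, 2 ^ i + 3 * 2 ^ e - 2 ^ 3

end SqrtTwoQuaternion

/-! Write `rep a` for the number of cubians of reduced norm `a`, and `subRep a` for the number of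
those lying in the suborder. Two facts give the formula: the cubian order is Euclidean for the
reduced norm, and the suborder is an Eichler order of level `4 = (√2)⁴` whose local structure the
cubian units see completely.

Counting cubians. In doubled coordinates the cubian order is the lattice of the extended Hamming
code, a scaled E₈, and its small covering radius gives division with remainder (`Cubian.division`);
one-sided ideals are therefore principal. For a totally positive prime `π` with residue field `F`,
the order modulo `π` is the ring of 2×2 matrices over `F`. Each of the `|F| + 1` points of the
projective line gives a right ideal, generated by an element of norm `π`. Double counting pairs
(cubian of norm `πa`, point) gives the Hecke relations `rep_mul_of_not_dvd` and `rep_mul_mul`.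
Divisor sums obey the same relations, and `rep 1 = 48`. Hence `rep b` is 48 times the divisor sum
for `b` prime to `√2`, and `rep (ϖ ^ k * b) = (2 ^ (k + 1) - 1) * rep b` for the totally positive
generator `ϖ = 2 + √2` of the prime above 2.

Passing to the suborder. Modulo 4 the cubians act as 2×2 matrices, and the suborder consists of
those whose lower left entry vanishes. The 24 norm-one units modulo `±1` permute the 24 points of
the projective line over `ℤ[√2]/4` simply transitively. So the number of units `u` with `u * q` in
the suborder depends only on the largest `k ≤ 4` for which the first column of `q` is divisible by
`ϖ ^ k` (`card_unitRep_filter`). The cubians with that divisibility form a principal left ideal with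
generator of norm `ϖ ^ k`. Thus `24 * subRep a` is a combination of the numbers `rep (a / ϖ ^ k)`,
which is evaluated in `subRep_rtPos_pow_mul`. -/

namespace SqrtTwoQuaternion

/-! ### Euclidean division, and arithmetic of `ℤ[√2]` -/

/-- In a ring with a Euclidean division on the left, every right ideal is generated by one
element. -/
theorem exists_right_ideal_generator {A : Type*} [Ring A] (ν : A → ℕ)
    (hdiv : ∀ a b : A, b ≠ 0 → ∃ q, ν (a - b * q) < ν b) (J : AddSubgroup A)
    (hJ : ∀ x ∈ J, ∀ y, x * y ∈ J) : ∃ ρ ∈ J, ∀ x ∈ J, ∃ y, x = ρ * y := by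
  classical
  by_cases h : ∃ x ∈ J, x ≠ 0
  · have hex : ∃ m, ∃ x ∈ J, x ≠ 0 ∧ ν x = m := by
      obtain ⟨x, hx, hx0⟩ := h
      exact ⟨_, x, hx, hx0, rfl⟩
    obtain ⟨ρ, hρ, hρ0, hm⟩ := Nat.find_spec hex
    refine ⟨ρ, hρ, fun x hx => ?_⟩
    obtain ⟨q, hq⟩ := hdiv x ρ hρ0
    refine ⟨q, ?_⟩
    by_contra hne
    have := Nat.find_min' hex
      ⟨x - ρ * q, J.sub_mem hx (hJ _ hρ q), sub_ne_zero.2 hne, rfl⟩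
    omega
  · push Not at h
    exact ⟨0, J.zero_mem, fun x hx => ⟨0, by rw [h x hx, mul_zero]⟩⟩

/-- The ring `ℤ[√2]`. -/
abbrev ZSqrtTwo := ℤ√2

/-- The element `√2` of `ℤ[√2]`. -/
def rt : ZSqrtTwo := ⟨0, 1⟩

@[simp] theorem rt_re : rt.re = 0 := rfl

@[simp] theorem rt_im : rt.im = 1 := rfl

theorem rt_sq : rt * rt = 2 := by decide

theorem two_ne_mul_self (n : ℤ) : (2 : ℤ) ≠ n * n := by
  intro h
  have h1 : n < 2 := by nlinarith
  have h2 : -2 < n := by nlinarith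
  interval_cases n <;> omega

theorem norm_eq_zero_iff_eq_zero (a : ZSqrtTwo) : a.norm = 0 ↔ a = 0 :=
  Zsqrtd.norm_eq_zero two_ne_mul_self a

instance : IsDomain ZSqrtTwo :=
  have : NoZeroDivisors ZSqrtTwo := ⟨fun {a b} h => by
    have h' := congrArg Zsqrtd.norm h
    rw [Zsqrtd.norm_mul, Zsqrtd.norm_zero, mul_eq_zero] at h'
    exact h'.imp (norm_eq_zero_iff_eq_zero a).1 (norm_eq_zero_iff_eq_zero b).1⟩
  NoZeroDivisors.to_isDomain _

theorem exists_centered_quotient (a n : ℤ) (hn : 0 < n) : ∃ q : ℤ, 2 * |a - n * q| ≤ n := by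
  refine ⟨(2 * a + n) / (2 * n), ?_⟩
  have h1 := Int.emod_nonneg (2 * a + n) (show 2 * n ≠ 0 by omega)
  have h2 := Int.emod_lt_of_pos (2 * a + n) (show 0 < 2 * n by omega)
  have h3 := Int.emod_add_mul_ediv (2 * a + n) (2 * n)
  set q := (2 * a + n) / (2 * n)
  rcases abs_cases (a - n * q) with h | h <;> rw [h.1] <;> linarith

theorem zsqrtTwo_division (a b : ZSqrtTwo) (hb : b ≠ 0) :
    ∃ q, (a - b * q).norm.natAbs < b.norm.natAbs := by
  have hN : b.norm ≠ 0 := fun h => hb ((norm_eq_zero_iff_eq_zero b).1 h)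
  have hc : ∃ q : ZSqrtTwo, (a * star b - b.norm * q).norm.natAbs < (b.norm * b.norm).natAbs := by
    obtain ⟨u, hu⟩ := exists_centered_quotient (a * star b).re |b.norm| (abs_pos.2 hN)
    obtain ⟨v, hv⟩ := exists_centered_quotient (a * star b).im |b.norm| (abs_pos.2 hN)
    -- The quotient `a / b = a * star b / b.norm` is rounded in both coordinates; the sign
    -- compensates for rounding with respect to `|b.norm|`. The errors satisfy `|x|, |y| ≤ n / 2`,
    -- so `|x² - 2y²| ≤ n² / 2`.
    refine ⟨⟨b.norm.sign * u, b.norm.sign * v⟩, ?_⟩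
    have hs (x : ℤ) : b.norm * (b.norm.sign * x) = |b.norm| * x := by
      rw [← mul_assoc, Int.mul_sign_self, Int.abs_eq_natAbs]
    have h0 := abs_pos.2 hN
    rw [Zsqrtd.norm_def]
    simp only [Zsqrtd.re_sub, Zsqrtd.im_sub, Zsqrtd.re_smul, Zsqrtd.im_smul,
      hs]
    generalize (a * star b).re - |b.norm| * u = x at hu
    generalize (a * star b).im - |b.norm| * v = y at hv
    rw [← abs_mul_abs_self b.norm]
    generalize |b.norm| = n at *
    have hx : 4 * (x * x) ≤ n * n := by
      rw [← abs_mul_abs_self x]; nlinarith [abs_nonneg x]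
    have hy : 4 * (y * y) ≤ n * n := by
      rw [← abs_mul_abs_self y]; nlinarith [abs_nonneg y]
    have hn : 0 < n * n := by positivity
    have hx' := mul_self_nonneg x
    have hy' := mul_self_nonneg y
    rw [mul_assoc 2]
    generalize x * x = X at *
    generalize y * y = Y at *
    generalize n * n = N at *
    omega
  obtain ⟨q, hq⟩ := hc
  refine ⟨q, ?_⟩
  have h1 : (a - b * q) * star b = a * star b - b.norm * q := by
    rw [Zsqrtd.norm_eq_mul_conj]; ring
  rw [← h1, Zsqrtd.norm_mul, Zsqrtd.norm_conj, Int.natAbs_mul, Int.natAbs_mul] at hq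
  exact lt_of_mul_lt_mul_right hq (Nat.zero_le _)

instance : IsPrincipalIdealRing ZSqrtTwo where
  principal I := by
    obtain ⟨ρ, hρ, h⟩ := exists_right_ideal_generator (fun a : ZSqrtTwo => a.norm.natAbs)
      zsqrtTwo_division I.toAddSubgroup (fun x hx y => I.mul_mem_right y hx)
    refine ⟨ρ, le_antisymm (fun x hx => ?_) ?_⟩
    · obtain ⟨y, rfl⟩ := h x hx
      exact Ideal.mem_span_singleton.2 ⟨y, rfl⟩
    · exact (Ideal.span_singleton_le_iff_mem _).2 hρ

/-- The embedding of `ℤ[√2]` into `ℝ` with `√2 ↦ √2`. -/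
noncomputable def emb : ZSqrtTwo →+* ℝ := Zsqrtd.toReal (by norm_num)

/-- The embedding of `ℤ[√2]` into `ℝ` with `√2 ↦ -√2`. -/
noncomputable def emb' : ZSqrtTwo →+* ℝ := emb.comp (starRingEnd ZSqrtTwo)

theorem emb_apply (a : ZSqrtTwo) : emb a = a.re + a.im * √2 := by
  simp [emb, Zsqrtd.toReal]

theorem emb'_apply (a : ZSqrtTwo) : emb' a = a.re - a.im * √2 := by
  simp [emb', emb_apply, sub_eq_add_neg, starRingEnd_apply]

theorem emb_mul_emb' (a : ZSqrtTwo) : emb a * emb' a = a.norm := by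
  have h : √2 * √2 = 2 := Real.mul_self_sqrt (by norm_num)
  rw [emb_apply, emb'_apply, Zsqrtd.norm_def]
  push_cast
  linear_combination (-(a.im : ℝ) ^ 2) * h

/-- An element of `ℤ[√2]` is totally positive if both of its real conjugates are positive. -/
def TotPos (a : ZSqrtTwo) : Prop := 0 < emb a ∧ 0 < emb' a

namespace TotPos

theorem one : TotPos 1 := by simp [TotPos]

theorem mul {a b : ZSqrtTwo} (ha : TotPos a) (hb : TotPos b) : TotPos (a * b) := by
  simp only [TotPos, map_mul]
  exact ⟨mul_pos ha.1 hb.1, mul_pos ha.2 hb.2⟩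

theorem pow {a : ZSqrtTwo} (ha : TotPos a) (n : ℕ) : TotPos (a ^ n) := by
  simp only [TotPos, map_pow]
  exact ⟨pow_pos ha.1 n, pow_pos ha.2 n⟩

theorem of_mul_left {a b : ZSqrtTwo} (hab : TotPos (a * b)) (ha : TotPos a) : TotPos b := by
  simp only [TotPos, map_mul] at hab
  exact ⟨(mul_pos_iff_of_pos_left ha.1).1 hab.1, (mul_pos_iff_of_pos_left ha.2).1 hab.2⟩

theorem ne_zero {a : ZSqrtTwo} (ha : TotPos a) : a ≠ 0 := by
  rintro rfl
  simpa using ha.1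

theorem norm_pos {a : ZSqrtTwo} (ha : TotPos a) : 0 < a.norm := by
  have := mul_pos ha.1 ha.2
  rw [emb_mul_emb'] at this
  exact_mod_cast this

theorem of_re_pos_of_norm_pos {a : ZSqrtTwo} (h1 : 0 < a.re) (h2 : 0 < a.norm) : TotPos a := by
  have h3 : (0 : ℝ) < emb a * emb' a := by rw [emb_mul_emb']; exact_mod_cast h2
  have h4 : (0 : ℝ) < emb a + emb' a := by
    rw [emb_apply, emb'_apply]
    have : (0 : ℝ) < a.re := by exact_mod_cast h1
    linarith
  constructor <;> nlinarith

end TotPos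

/-- The unit `1 + √2` has norm `-1`, so together with `-1` it realises all sign patterns at the two
real places. -/
theorem exists_totPos_associated (a : ZSqrtTwo) (ha : a ≠ 0) : ∃ b, Associated a b ∧ TotPos b := by
  have key : ∀ a : ZSqrtTwo, 0 < a.norm → ∃ b, Associated a b ∧ TotPos b := by
    intro a h
    rcases lt_trichotomy a.re 0 with h' | h' | h'
    · exact ⟨-a, Associated.neg_right (Associated.refl a),
        .of_re_pos_of_norm_pos (by simpa using h') (by simpa using h)⟩
    · rw [Zsqrtd.norm_def, h'] at h
      nlinarith [mul_self_nonneg a.im]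
    · exact ⟨a, Associated.refl a, .of_re_pos_of_norm_pos h' h⟩
  have hN : a.norm ≠ 0 := fun h => ha ((norm_eq_zero_iff_eq_zero a).1 h)
  rcases hN.lt_or_gt with h | h
  · have hu : IsUnit (⟨1, 1⟩ : ZSqrtTwo) := IsUnit.of_mul_eq_one ⟨-1, 1⟩ (by decide)
    obtain ⟨b, hb, hb'⟩ := key (a * ⟨1, 1⟩) (by
      rw [Zsqrtd.norm_mul]
      have : (⟨1, 1⟩ : ZSqrtTwo).norm = -1 := by decide
      rw [this]; linarith)
    exact ⟨b, (associated_mul_unit_right a _ hu).trans hb, hb'⟩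
  · exact key a h

/-- Units of norm 1 solve the Pell equation, hence are `±(3 + 2√2) ^ k`; here `3 + 2√2 = (1 + √2)²`,
and total positivity excludes the minus sign. This lets the norm of a generator be adjusted by a
unit by rescaling the generator. -/
theorem TotPos.isSquare_of_isUnit {a : ZSqrtTwo} (ha : TotPos a) (hu : IsUnit a) :
    ∃ b : ZSqrtTwoˣ, a = b ^ 2 := by
  have hn : a.norm = 1 := by
    have h1 := Zsqrtd.norm_eq_one_iff.2 hu
    have h2 := ha.norm_pos
    omega
  let P : Pell.Solution₁ 2 := Pell.Solution₁.mk a.re a.im (by rw [Zsqrtd.norm_def] at hn; linarith)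
  let Q : Pell.Solution₁ 2 := Pell.Solution₁.mk 3 2 (by norm_num)
  have hQ : Pell.IsFundamental Q := by
    refine ⟨by decide, by decide, fun {c} hc => ?_⟩
    by_contra h
    have h1 := c.prop
    have h3 : c.x < 3 := not_le.1 h
    have h4 : c.x = 2 := by omega
    rw [h4] at h1
    omega
  obtain ⟨k, hk⟩ := hQ.eq_zpow_or_neg_zpow P
  let ε : ZSqrtTwoˣ := ⟨⟨1, 1⟩, ⟨-1, 1⟩, by decide, by decide⟩
  let c : Pell.Solution₁ 2 →* ZSqrtTwoˣ := Unitary.toUnits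
  have hcQ : c Q = ε ^ 2 := by
    ext1
    decide
  have hcP : (c P : ZSqrtTwo) = a := rfl
  have hsq : ((c (Q ^ k) : ZSqrtTwoˣ) : ZSqrtTwo) = ((ε ^ k : ZSqrtTwoˣ) : ZSqrtTwo) ^ 2 := by
    rw [map_zpow, hcQ, ← Units.val_pow_eq_pow_val, ← zpow_natCast, ← zpow_natCast, zpow_comm]
  rcases hk with hk | hk
  · exact ⟨ε ^ k, by rw [← hcP, hk, hsq]⟩
  · exfalso
    have h1 : a = -((ε ^ k : ZSqrtTwoˣ) : ZSqrtTwo) ^ 2 := by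
      rw [← hcP, hk, ← hsq]
      rfl
    have h2 := ha.1
    rw [h1, map_neg, map_pow] at h2
    nlinarith [sq_nonneg (emb ((ε ^ k : ZSqrtTwoˣ) : ZSqrtTwo))]

/-! ### The cubian order as a ring over `ℤ[√2]` -/

/-- The cubian order, in coordinates with respect to the basis
`1, (1 + i) / √2, (1 + j) / √2, (1 + i + j + k) / 2` over `ℤ[√2]`. -/
@[ext]
structure Cubian where
  /-- The coordinate at `1`. -/
  c0 : ZSqrtTwo
  /-- The coordinate at `(1 + i) / √2`. -/
  c1 : ZSqrtTwo
  /-- The coordinate at `(1 + j) / √2`. -/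
  c2 : ZSqrtTwo
  /-- The coordinate at `(1 + i + j + k) / 2`. -/
  c3 : ZSqrtTwo
deriving DecidableEq

namespace Cubian

instance : Zero Cubian := ⟨⟨0, 0, 0, 0⟩⟩
instance : One Cubian := ⟨⟨1, 0, 0, 0⟩⟩
instance : Add Cubian := ⟨fun x y => ⟨x.c0 + y.c0, x.c1 + y.c1, x.c2 + y.c2, x.c3 + y.c3⟩⟩
instance : Neg Cubian := ⟨fun x => ⟨-x.c0, -x.c1, -x.c2, -x.c3⟩⟩
instance : Mul Cubian := ⟨fun x y =>
  ⟨x.c0 * y.c0 - x.c1 * y.c1 - x.c2 * y.c1 - x.c2 * y.c2 - rt * (x.c2 * y.c3) - rt * (x.c3 * y.c1)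
      - x.c3 * y.c3,
    x.c0 * y.c1 + x.c1 * y.c0 + rt * (x.c1 * y.c1) + rt * (x.c2 * y.c1) + x.c2 * y.c3
      + x.c3 * y.c1 - x.c3 * y.c2,
    x.c0 * y.c2 + x.c2 * y.c0 + rt * (x.c2 * y.c1) + rt * (x.c2 * y.c2) + x.c2 * y.c3
      + x.c3 * y.c1 - x.c1 * y.c3,
    x.c0 * y.c3 + x.c3 * y.c0 + x.c1 * y.c2 + rt * (x.c1 * y.c3) - x.c2 * y.c1
      + rt * (x.c3 * y.c2) + x.c3 * y.c3⟩⟩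

@[simp] theorem zero_c0 : (0 : Cubian).c0 = 0 := rfl
@[simp] theorem zero_c1 : (0 : Cubian).c1 = 0 := rfl
@[simp] theorem zero_c2 : (0 : Cubian).c2 = 0 := rfl
@[simp] theorem zero_c3 : (0 : Cubian).c3 = 0 := rfl
@[simp] theorem one_c0 : (1 : Cubian).c0 = 1 := rfl
@[simp] theorem one_c1 : (1 : Cubian).c1 = 0 := rfl
@[simp] theorem one_c2 : (1 : Cubian).c2 = 0 := rfl
@[simp] theorem one_c3 : (1 : Cubian).c3 = 0 := rfl

variable (x y : Cubian)

@[simp] theorem add_c0 : (x + y).c0 = x.c0 + y.c0 := rfl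
@[simp] theorem add_c1 : (x + y).c1 = x.c1 + y.c1 := rfl
@[simp] theorem add_c2 : (x + y).c2 = x.c2 + y.c2 := rfl
@[simp] theorem add_c3 : (x + y).c3 = x.c3 + y.c3 := rfl
@[simp] theorem neg_c0 : (-x).c0 = -x.c0 := rfl
@[simp] theorem neg_c1 : (-x).c1 = -x.c1 := rfl
@[simp] theorem neg_c2 : (-x).c2 = -x.c2 := rfl
@[simp] theorem neg_c3 : (-x).c3 = -x.c3 := rfl
theorem mul_c0 : (x * y).c0 = x.c0 * y.c0 - x.c1 * y.c1 - x.c2 * y.c1 - x.c2 * y.c2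
    - rt * (x.c2 * y.c3) - rt * (x.c3 * y.c1) - x.c3 * y.c3 := rfl
theorem mul_c1 : (x * y).c1 = x.c0 * y.c1 + x.c1 * y.c0 + rt * (x.c1 * y.c1) + rt * (x.c2 * y.c1)
    + x.c2 * y.c3 + x.c3 * y.c1 - x.c3 * y.c2 := rfl
theorem mul_c2 : (x * y).c2 = x.c0 * y.c2 + x.c2 * y.c0 + rt * (x.c2 * y.c1) + rt * (x.c2 * y.c2)
    + x.c2 * y.c3 + x.c3 * y.c1 - x.c1 * y.c3 := rfl
theorem mul_c3 : (x * y).c3 = x.c0 * y.c3 + x.c3 * y.c0 + x.c1 * y.c2 + rt * (x.c1 * y.c3)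
    - x.c2 * y.c1 + rt * (x.c3 * y.c2) + x.c3 * y.c3 := rfl

instance : Ring Cubian :=
  Ring.ofMinimalAxioms
    (fun x y z => by ext1 <;> simp [add_assoc])
    (fun x => by ext1 <;> simp)
    (fun x => by ext1 <;> simp)
    (fun x y z => by
      have h := rt_sq
      ext1 <;> simp only [mul_c0, mul_c1, mul_c2, mul_c3] <;> generalize rt = s at * <;> grind)
    (fun x => by ext1 <;> simp [mul_c0, mul_c1, mul_c2, mul_c3])
    (fun x => by ext1 <;> simp [mul_c0, mul_c1, mul_c2, mul_c3])
    (fun x y z => by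
      ext1 <;> simp only [mul_c0, mul_c1, mul_c2, mul_c3, add_c0, add_c1, add_c2, add_c3] <;> ring)
    (fun x y z => by
      ext1 <;> simp only [mul_c0, mul_c1, mul_c2, mul_c3, add_c0, add_c1, add_c2, add_c3] <;> ring)

@[simp] theorem sub_c0 : (x - y).c0 = x.c0 - y.c0 := by simp [sub_eq_add_neg]
@[simp] theorem sub_c1 : (x - y).c1 = x.c1 - y.c1 := by simp [sub_eq_add_neg]
@[simp] theorem sub_c2 : (x - y).c2 = x.c2 - y.c2 := by simp [sub_eq_add_neg]
@[simp] theorem sub_c3 : (x - y).c3 = x.c3 - y.c3 := by simp [sub_eq_add_neg]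

/-- The inclusion of the scalars `ℤ[√2]`. -/
def scalar : ZSqrtTwo →+* Cubian where
  toFun r := ⟨r, 0, 0, 0⟩
  map_zero' := rfl
  map_one' := rfl
  map_add' r r' := by ext1 <;> simp
  map_mul' r r' := by ext1 <;> simp [mul_c0, mul_c1, mul_c2, mul_c3]

@[simp] theorem scalar_c0 (r : ZSqrtTwo) : (scalar r).c0 = r := rfl
@[simp] theorem scalar_c1 (r : ZSqrtTwo) : (scalar r).c1 = 0 := rfl
@[simp] theorem scalar_c2 (r : ZSqrtTwo) : (scalar r).c2 = 0 := rfl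
@[simp] theorem scalar_c3 (r : ZSqrtTwo) : (scalar r).c3 = 0 := rfl

theorem scalar_mul (r : ZSqrtTwo) : scalar r * x = ⟨r * x.c0, r * x.c1, r * x.c2, r * x.c3⟩ := by
  ext1 <;> simp [mul_c0, mul_c1, mul_c2, mul_c3]

theorem scalar_comm (r : ZSqrtTwo) : scalar r * x = x * scalar r := by
  ext1 <;> simp [mul_c0, mul_c1, mul_c2, mul_c3, mul_comm]

theorem scalar_injective : Function.Injective scalar := fun _ _ h => congrArg c0 h

theorem scalar_mul_cancel {r : ZSqrtTwo} (hr : r ≠ 0) {x y : Cubian}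
    (h : scalar r * x = scalar r * y) : x = y := by
  rw [scalar_mul, scalar_mul, Cubian.mk.injEq] at h
  exact Cubian.ext (mul_left_cancel₀ hr h.1) (mul_left_cancel₀ hr h.2.1)
    (mul_left_cancel₀ hr h.2.2.1) (mul_left_cancel₀ hr h.2.2.2)

/-- The conjugate of a cubian. -/
def conj : Cubian := ⟨x.c0 + rt * x.c1 + rt * x.c2 + x.c3, -x.c1, -x.c2, -x.c3⟩

/-- The reduced norm of a cubian. -/
def nrd : ZSqrtTwo :=
  x.c0 * x.c0 + x.c1 * x.c1 + x.c2 * x.c2 + x.c3 * x.c3 + rt * (x.c0 * x.c1) + rt * (x.c0 * x.c2)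
    + x.c0 * x.c3 + x.c1 * x.c2 + rt * (x.c1 * x.c3) + rt * (x.c2 * x.c3)

theorem mul_conj : x * conj x = scalar (nrd x) := by
  have h := rt_sq
  ext1 <;> simp only [mul_c0, mul_c1, mul_c2, mul_c3, conj, nrd, scalar_c0, scalar_c1, scalar_c2,
    scalar_c3] <;> generalize rt = s at * <;> grind

theorem conj_mul_self : conj x * x = scalar (nrd x) := by
  have h := rt_sq
  ext1 <;> simp only [mul_c0, mul_c1, mul_c2, mul_c3, conj, nrd, scalar_c0, scalar_c1, scalar_c2,
    scalar_c3] <;> generalize rt = s at * <;> grind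

theorem conj_mul : conj (x * y) = conj y * conj x := by
  have h := rt_sq
  ext1 <;> simp only [mul_c0, mul_c1, mul_c2, mul_c3, conj] <;> generalize rt = s at * <;> grind

@[simp] theorem nrd_mul : nrd (x * y) = nrd x * nrd y := by
  apply scalar_injective
  rw [← mul_conj, conj_mul, mul_assoc, ← mul_assoc y, mul_conj, scalar_comm, ← mul_assoc, mul_conj,
    map_mul]

@[simp] theorem nrd_zero : nrd 0 = 0 := by simp [nrd]

@[simp] theorem nrd_scalar (r : ZSqrtTwo) : nrd (scalar r) = r * r := by simp [nrd]

@[simp] theorem nrd_conj : nrd (conj x) = nrd x := by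
  have h := rt_sq
  simp only [conj, nrd]
  generalize rt = s at *
  grind

end Cubian

/-! ### Euclidean division in the cubian order -/

/-- An extended Hamming code of length `8`. -/
def IsCodeword (p : Fin 8 → ZMod 2) : Prop :=
  p 4 + p 5 + p 6 + p 7 = 0 ∧ p 0 + p 4 = p 1 + p 5 ∧ p 0 + p 4 = p 2 + p 6 ∧ p 0 + p 4 = p 3 + p 7

instance : DecidablePred IsCodeword := fun _ => inferInstanceAs (Decidable (_ ∧ _))

/-- Every word is a codeword, or has distance `1` from a codeword, or it becomes a codeword after
the change of any of four disjoint pairs of entries. -/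
theorem isCodeword_covering : ∀ p : Fin 8 → ZMod 2, IsCodeword p ∨
    (∃ i, IsCodeword (fun k => p k + if k = i then 1 else 0)) ∨
    ∃ d : Fin 8, d ≠ 0 ∧ ∀ i, IsCodeword (fun k => p k + if k = i ∨ k = i ^^^ d then 1 else 0) := by
  decide +kernel

/-- A bound on the covering radius of the Hamming lattice. Each `Y k / N` is rounded to `b k`, with
error `δ k / N ≤ 1/2`. Changing `b k` by one in the right direction turns the error into `1 - δ k /
N` and flips the parity. The worst case is one flip: `1 + 7/4 = 11/4`. -/
theorem exists_near_codeword (Y : Fin 8 → ℤ) (N : ℤ) (hN : 0 < N) :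
    ∃ l : Fin 8 → ℤ, IsCodeword (fun k => (l k : ZMod 2)) ∧
      4 * ∑ k, (Y k - N * l k) ^ 2 ≤ 11 * N ^ 2 := by
  choose b hb using fun k => exists_centered_quotient (Y k) N hN
  set δ : Fin 8 → ℤ := fun k => |Y k - N * b k| with hδ
  have hδ0 (k) : 0 ≤ δ k := abs_nonneg _
  have hδN (k) : 2 * δ k ≤ N := hb k
  have hε (k) : ∃ ε : ℤ, (ε : ZMod 2) = 1 ∧ (Y k - N * (b k + ε)) ^ 2 = (N - δ k) ^ 2 := by
    rcases abs_cases (Y k - N * b k) with h | h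
    · exact ⟨1, by decide, by simp only [hδ, h.1]; ring⟩
    · exact ⟨-1, by decide, by simp only [hδ, h.1]; ring⟩
  choose ε hε1 hε2 using hε
  have hsq (k) : (Y k - N * b k) ^ 2 = δ k ^ 2 := (sq_abs _).symm
  have key (f : Fin 8 → Prop) [DecidablePred f]
      (hf : IsCodeword (fun k => (b k : ZMod 2) + if f k then 1 else 0))
      (hc : 4 * ∑ k, (if f k then N - δ k else δ k) ^ 2 ≤ 11 * N ^ 2) :
      ∃ l : Fin 8 → ℤ, IsCodeword (fun k => (l k : ZMod 2)) ∧
      4 * ∑ k, (Y k - N * l k) ^ 2 ≤ 11 * N ^ 2 := by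
    refine ⟨fun k => b k + if f k then ε k else 0, ?_, ?_⟩
    · have h1 : (fun k => ((b k + if f k then ε k else 0 : ℤ) : ZMod 2)) =
          fun k => (b k : ZMod 2) + if f k then 1 else 0 := by
        funext k
        by_cases h : f k <;> simp [h, hε1]
      rwa [h1]
    · have h1 (k) : (Y k - N * (b k + if f k then ε k else 0)) ^ 2 =
          (if f k then N - δ k else δ k) ^ 2 := by
        by_cases h : f k <;> simp [h, hε2, hsq]
      simpa only [h1] using hc
  have hq (k) : 4 * δ k ^ 2 ≤ 2 * N * δ k := by nlinarith [hδ0 k, hδN k]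
  have hq' (k) : 4 * δ k ^ 2 ≤ N ^ 2 := by nlinarith [hδ0 k, hδN k]
  rcases isCodeword_covering (fun k => (b k : ZMod 2)) with h | ⟨i, h⟩ | ⟨d, hd, h⟩
  · refine key (fun _ => False) (by simpa using h) ?_
    simp only [if_false, Finset.mul_sum]
    refine (Finset.sum_le_sum fun k _ => hq' k).trans ?_
    simp
    nlinarith
  · refine key (fun k => k = i) h ?_
    have h1 : ∑ k, 4 * (if k = i then N - δ k else δ k) ^ 2
        ≤ ∑ k, (N ^ 2 + if k = i then 3 * N ^ 2 else 0) := by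
      refine Finset.sum_le_sum fun k _ => ?_
      split_ifs
      · nlinarith [hδ0 k, hδN k]
      · linarith [hq' k]
    rw [← Finset.mul_sum] at h1
    refine h1.trans ?_
    simp [Finset.sum_add_distrib]
    linarith
  -- One of the four pairs is cheap enough to flip: averaged over `i`, the cost is at most `2 * N ^
  -- 2`, since `4 * δ k ^ 2 ≤ 2 * N * δ k`.
  · have hex : ∃ i, N ^ 2 * 2 - 2 * N * (δ i + δ (i ^^^ d)) + ∑ k, δ k ^ 2 ≤ 2 * N ^ 2 := by
      by_contra! hcon
      have h1 := Finset.sum_lt_sum_of_nonempty (s := Finset.univ) Finset.univ_nonempty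
        fun i _ => hcon i
      have h2 : ∑ i, δ (i ^^^ d) = ∑ i, δ i :=
        Equiv.sum_comp (Function.Involutive.toPerm (fun i : Fin 8 => i ^^^ d)
          ((by decide : ∀ d i : Fin 8, i ^^^ d ^^^ d = i) d)) δ
      have h3 := Finset.sum_le_sum (s := Finset.univ) fun k _ => hq k
      simp only [Finset.sum_add_distrib, Finset.sum_sub_distrib, ← Finset.mul_sum, h2] at h1 h3
      simp at h1
      linarith
    obtain ⟨i, hi⟩ := hex
    refine key (fun k => k = i ∨ k = i ^^^ d) (h i) ?_
    have hne : i ^^^ d ≠ i := (by decide : ∀ d i : Fin 8, d ≠ 0 → i ^^^ d ≠ i) d i hd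
    have h1 (k : Fin 8) : (if k = i ∨ k = i ^^^ d then N - δ k else δ k) ^ 2
        = δ k ^ 2 + ((if k = i then N ^ 2 - 2 * N * δ k else 0)
          + if k = i ^^^ d then N ^ 2 - 2 * N * δ k else 0) := by
      by_cases h1 : k = i
      · subst h1
        simp [hne.symm]
        ring
      · by_cases h2 : k = i ^^^ d
        · simp [h2, hne]
          ring
        · simp [h1, h2]
    simp only [h1, Finset.sum_add_distrib, Finset.sum_ite_eq', Finset.mem_univ, if_true]
    nlinarith

namespace Cubian

theorem four_mul_nrd (x : Cubian) : 4 * nrd x = (2 * x.c0 + rt * x.c1 + rt * x.c2 + x.c3) ^ 2 +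
    (rt * x.c1 + x.c3) ^ 2 + (rt * x.c2 + x.c3) ^ 2 + x.c3 ^ 2 := by
  have h := rt_sq
  simp only [nrd]
  generalize rt = s at *
  grind

theorem map_nrd_nonneg (f : ZSqrtTwo →+* ℝ) (x : Cubian) : 0 ≤ f (nrd x) := by
  have h := congrArg f (four_mul_nrd x)
  rw [map_mul, map_add, map_add, map_add, map_pow, map_pow, map_pow, map_pow, map_ofNat] at h
  have : 0 ≤ 4 * f (nrd x) := by rw [h]; positivity
  linarith

theorem nrd_norm_nonneg (x : Cubian) : 0 ≤ (nrd x).norm := by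
  have := mul_nonneg (map_nrd_nonneg emb x) (map_nrd_nonneg emb' x)
  rw [emb_mul_emb'] at this
  exact_mod_cast this

theorem nrd_eq_zero {x : Cubian} : nrd x = 0 ↔ x = 0 := by
  refine ⟨fun hx => ?_, fun h => by rw [h, nrd_zero]⟩
  have hinj (r : ZSqrtTwo) (h : emb r = 0) : r = 0 :=
    (map_eq_zero_iff emb (Zsqrtd.toReal_injective _ two_ne_mul_self)).1 h
  have h := congrArg emb (four_mul_nrd x)
  rw [hx, map_add, map_add, map_add, map_pow, map_pow, map_pow, map_pow, mul_zero, map_zero] at h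
  have e (r : ZSqrtTwo) (h : emb r ^ 2 ≤ 0) : r = 0 :=
    hinj r (pow_eq_zero_iff two_ne_zero |>.1 (le_antisymm h (sq_nonneg _)))
  have hrt : rt ≠ 0 := by decide
  have q0 := sq_nonneg (emb (2 * x.c0 + rt * x.c1 + rt * x.c2 + x.c3))
  have q1 := sq_nonneg (emb (rt * x.c1 + x.c3))
  have q2 := sq_nonneg (emb (rt * x.c2 + x.c3))
  have q3 := sq_nonneg (emb x.c3)
  have h3 := e x.c3 (by linarith)
  have h2 := e (rt * x.c2 + x.c3) (by linarith)
  have h1 := e (rt * x.c1 + x.c3) (by linarith)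
  have h0 := e (2 * x.c0 + rt * x.c1 + rt * x.c2 + x.c3) (by linarith)
  rw [h3, add_zero] at h1 h2 h0
  have h1' : x.c1 = 0 := (mul_eq_zero.1 h1).resolve_left hrt
  have h2' : x.c2 = 0 := (mul_eq_zero.1 h2).resolve_left hrt
  rw [h1', h2', mul_zero, add_zero, add_zero] at h0
  exact Cubian.ext ((mul_eq_zero.1 h0).resolve_left (by decide)) h1' h2' h3

/-- If the sum of squares is `A + B√2`, the bracket on the right is `A - B`, and `2(A - B)² - (A² -
2B²) = (A - 2B)²`. -/
theorem norm_sum_sq_le (t u v z : ZSqrtTwo) : (t ^ 2 + u ^ 2 + v ^ 2 + z ^ 2).norm ≤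
    2 * ((t.re - t.im) ^ 2 + t.im ^ 2 + ((u.re - u.im) ^ 2 + u.im ^ 2) +
      ((v.re - v.im) ^ 2 + v.im ^ 2) + ((z.re - z.im) ^ 2 + z.im ^ 2)) ^ 2 := by
  rw [Zsqrtd.norm_def]
  simp only [sq, Zsqrtd.re_add, Zsqrtd.im_add, Zsqrtd.re_mul, Zsqrtd.im_mul]
  nlinarith [sq_nonneg (t.re * t.re + 2 * t.im * t.im + (u.re * u.re + 2 * u.im * u.im) +
    (v.re * v.re + 2 * v.im * v.im) + (z.re * z.re + 2 * z.im * z.im)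
    - 4 * (t.re * t.im + u.re * u.im + v.re * v.im + z.re * z.im))]

/-- Twice the quaternion coordinates of `x`, written in the basis `1, 1 + √2` of `ℤ[√2]`. -/
def doubledCoords (x : Cubian) : Fin 8 → ℤ :=
  let t := 2 * x.c0 + rt * x.c1 + rt * x.c2 + x.c3
  let u := rt * x.c1 + x.c3
  let v := rt * x.c2 + x.c3
  ![t.re - t.im, u.re - u.im, v.re - v.im, x.c3.re - x.c3.im, t.im, u.im, v.im, x.c3.im]

theorem norm_nrd_le (x : Cubian) : 8 * (nrd x).norm ≤ (∑ k, doubledCoords x k ^ 2) ^ 2 := by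
  have h := congrArg Zsqrtd.norm (four_mul_nrd x)
  rw [Zsqrtd.norm_mul, show (4 : ZSqrtTwo).norm = 16 by decide] at h
  have key := norm_sum_sq_le (2 * x.c0 + rt * x.c1 + rt * x.c2 + x.c3) (rt * x.c1 + x.c3)
    (rt * x.c2 + x.c3) x.c3
  rw [← h] at key
  rw [Fin.sum_univ_eight]
  refine le_of_mul_le_mul_left (a := 2) ?_ two_pos
  calc _ = 16 * (nrd x).norm := by ring
    _ ≤ _ := key
    _ = _ := by
      simp only [doubledCoords, Matrix.cons_val]
      ring

/-- The codeword congruences are precisely the integrality conditions for the cubian coordinates;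
the witness solves the linear system. -/
theorem exists_doubledCoords_eq (l : Fin 8 → ℤ) (hl : IsCodeword (fun k => (l k : ZMod 2))) :
    ∃ x : Cubian, doubledCoords x = l := by
  obtain ⟨h0, h1, h2, h3⟩ := hl
  have hz (n : ℤ) (h : (n : ZMod 2) = 0) : ∃ m, n = 2 * m :=
    (ZMod.intCast_zmod_eq_zero_iff_dvd n 2).1 h
  obtain ⟨m0, h0⟩ := hz (l 4 + l 5 + l 6 + l 7) (by push_cast; exact h0)
  obtain ⟨m1, h1⟩ := hz (l 0 + l 4 - (l 1 + l 5)) (by push_cast; rw [h1, sub_self])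
  obtain ⟨m2, h2⟩ := hz (l 0 + l 4 - (l 2 + l 6)) (by push_cast; rw [h2, sub_self])
  obtain ⟨m3, h3⟩ := hz (l 0 + l 4 - (l 3 + l 7)) (by push_cast; rw [h3, sub_self])
  refine ⟨⟨⟨m1 + m2 - m3, m0 - l 5 - l 6⟩, ⟨l 5 - l 7, m3 - m1⟩, ⟨l 6 - l 7, m3 - m2⟩,
    ⟨l 3 + l 7, l 7⟩⟩, ?_⟩
  ext k
  fin_cases k <;> simp [doubledCoords] <;> linarith

theorem doubledCoords_sub_mul (x q : Cubian) (n : ℤ) (k : Fin 8) :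
    doubledCoords (x - scalar n * q) k = doubledCoords x k - n * doubledCoords q k := by
  rw [scalar_mul]
  fin_cases k <;> simp [doubledCoords] <;> ring

theorem exists_norm_nrd_sub_lt (x : Cubian) (n : ℤ) (hn : 0 < n) :
    ∃ q, (nrd (x - scalar n * q)).norm < n ^ 4 := by
  obtain ⟨l, hl, h⟩ := exists_near_codeword (doubledCoords x) n hn
  obtain ⟨q, rfl⟩ := exists_doubledCoords_eq l hl
  refine ⟨q, ?_⟩
  have h1 := norm_nrd_le (x - scalar n * q)
  simp only [doubledCoords_sub_mul] at h1
  have h2 : 0 ≤ ∑ k, (doubledCoords x k - n * doubledCoords q k) ^ 2 :=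
    Finset.sum_nonneg fun k _ => sq_nonneg _
  -- The bound is strict because `(11/4)² = 121/16 < 8`.
  nlinarith [pow_pos hn 4]

theorem division (a b : Cubian) (hb : b ≠ 0) :
    ∃ q, (nrd (a - b * q)).norm.natAbs < (nrd b).norm.natAbs := by
  have hN : 0 < (nrd b).norm := (nrd_norm_nonneg b).lt_of_ne' fun h =>
    hb (nrd_eq_zero.1 ((norm_eq_zero_iff_eq_zero _).1 h))
  -- Clearing denominators in `b⁻¹ * a` leaves a rational integer, the norm of `nrd b`, as divisor.
  -- The extra factors contribute its cube to the norm of the remainder, which is cancelled at the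
  -- end.
  obtain ⟨q, hq⟩ := exists_norm_nrd_sub_lt (scalar (star (nrd b)) * (conj b * a)) _ hN
  refine ⟨q, ?_⟩
  have h1 : scalar (star (nrd b)) * (conj b * a) - scalar (nrd b).norm * q
      = scalar (star (nrd b)) * (conj b * (a - b * q)) := by
    rw [mul_sub, mul_sub, ← mul_assoc (conj b), conj_mul_self, Zsqrtd.norm_eq_mul_conj, mul_comm,
      map_mul, mul_assoc]
  rw [h1, nrd_mul, nrd_mul, nrd_scalar, nrd_conj] at hq
  simp only [Zsqrtd.norm_mul, Zsqrtd.norm_conj] at hq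
  have h0 := nrd_norm_nonneg (a - b * q)
  zify
  rw [abs_of_pos hN, abs_of_nonneg h0]
  have h3 : 0 < (nrd b).norm ^ 3 := pow_pos hN 3
  refine lt_of_mul_lt_mul_left ?_ h3.le
  linarith

end Cubian

/-! ### Reduction of the cubian order to 2×2 matrices -/

namespace Cubian

section Matrix

variable {F : Type*} [CommRing F] (f : ZSqrtTwo →+* F) (x z : F)

/-- The matrix of `1, (1 + i) / √2, (1 + j) / √2` and their product under a representation
depending on a point `(x, z)` of a conic. -/
def toMat (q : Cubian) : Matrix (Fin 2) (Fin 2) F :=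
  !![f q.c0 + f q.c2 * x - f q.c3 * z,
      -f q.c1 + f q.c2 * (z - 1 + f rt * x) - f q.c3 * (f rt - x);
    f q.c1 + f q.c2 * z + f q.c3 * (x + f rt * z),
      f q.c0 + f rt * f q.c1 + f q.c2 * (f rt - x)
        + f q.c3 * (z - 1 + f rt * x + f rt * (f rt - x))]

theorem map_rt_sq : f rt * f rt = 2 := by rw [← map_mul, rt_sq, map_ofNat]

variable {x z} (h : z ^ 2 + f rt * x * z + x ^ 2 - z - f rt * x + 1 = 0)

-- The equation of the conic says that the image of `(1 + j) / √2`, which has trace `√2`, has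
-- determinant 1. No division by 2 is needed, so residue characteristic 2 is covered.
include h in
theorem toMat_mul (p q : Cubian) : toMat f x z (p * q) = toMat f x z p * toMat f x z q := by
  have hs := map_rt_sq f
  ext i j
  fin_cases i <;> fin_cases j <;>
    simp only [toMat, mul_c0, mul_c1, mul_c2, mul_c3, map_add, map_sub, map_mul, Matrix.mul_apply,
      Fin.sum_univ_two, Fin.zero_eta, Fin.mk_one, Matrix.of_apply, Matrix.cons_val] <;>
    generalize f rt = s at * <;> grind

include h in
theorem det_toMat (q : Cubian) : (toMat f x z q).det = f (nrd q) := by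
  have hs := map_rt_sq f
  rw [Matrix.det_fin_two]
  simp only [toMat, nrd, map_add, map_mul, Matrix.of_apply, Matrix.cons_val]
  generalize f rt = s at *
  grind

theorem toMat_add (p q : Cubian) : toMat f x z (p + q) = toMat f x z p + toMat f x z q := by
  ext i j
  fin_cases i <;> fin_cases j <;> simp [toMat] <;> ring

theorem toMat_scalar (r : ZSqrtTwo) : toMat f x z (scalar r) = f r • 1 := by
  ext i j
  fin_cases i <;> fin_cases j <;> simp [toMat]

include h in
theorem toMat_eq_zero {q : Cubian} (hq : toMat f x z q = 0) :
    f q.c0 = 0 ∧ f q.c1 = 0 ∧ f q.c2 = 0 ∧ f q.c3 = 0 := by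
  have hs := map_rt_sq f
  have e00 := congrFun (congrFun hq 0) 0
  have e01 := congrFun (congrFun hq 0) 1
  have e10 := congrFun (congrFun hq 1) 0
  have e11 := congrFun (congrFun hq 1) 1
  simp only [toMat, Matrix.of_apply, Matrix.cons_val, Matrix.zero_apply] at e00 e01 e10 e11
  generalize f rt = s at *
  generalize f q.c0 = a at *
  generalize f q.c1 = b at *
  generalize f q.c2 = c at *
  generalize f q.c3 = d at *
  have h2 : c = 0 := by grind
  have h3 : d = 0 := by grind
  subst h2 h3
  grind

-- `A` and `B` isolate the last two coordinates in the system `A = P c2 + Q c3`, `B = -Q c2 + (1 - s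
-- x) c3`. Its determinant is `-1` on the conic, so it is solved without division.
include h in
theorem toMat_surjective (hf : Function.Surjective f) : Function.Surjective (toMat f x z) := by
  intro M
  have hs := map_rt_sq f
  set s := f rt with hsdef
  let A := M 0 1 + M 1 0
  let B := M 1 1 - M 0 0 - s * M 1 0
  let P := 2 * z - 1 + s * x
  let Q := 2 * x + s * z - s
  let d2 := Q * B - (1 - s * x) * A
  let d3 := -(P * B + Q * A)
  obtain ⟨c2, h2⟩ := hf d2
  obtain ⟨c3, h3⟩ := hf d3
  obtain ⟨c1, h1⟩ := hf (M 1 0 - d2 * z - d3 * (x + s * z))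
  obtain ⟨c0, h0⟩ := hf (M 0 0 - d2 * x + d3 * z)
  refine ⟨⟨c0, c1, c2, c3⟩, ?_⟩
  ext i j
  fin_cases i <;> fin_cases j <;>
    simp only [toMat, h0, h1, h2, h3, ← hsdef, Fin.zero_eta, Fin.mk_one, Matrix.of_apply,
      Matrix.cons_val, d2, d3, A, B, P, Q] <;> clear_value s <;> grind

end Matrix

theorem exists_conic_point {F : Type*} [Field F] [Fintype F] (s : F) (hs : s * s = 2) :
    ∃ x z : F, z ^ 2 + s * x * z + x ^ 2 - z - s * x + 1 = 0 := by
  by_cases h2 : (2 : F) = 0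
  · refine ⟨1, 0, ?_⟩
    have : s = 0 := by simpa [h2] using hs
    rw [this]
    linear_combination h2
  · have hodd : Fintype.card F % 2 = 1 := by
      by_contra h
      apply h2
      have : ringChar F = 2 := FiniteField.even_card_iff_char_two.2 (by omega)
      have := ringChar.Nat.cast_ringChar (R := F)
      simp_all
    obtain ⟨u, v, huv⟩ := FiniteField.exists_root_sum_quadratic
      (f := (Polynomial.X ^ 2 : Polynomial F)) (g := Polynomial.X ^ 2 + Polynomial.C 2)
      (by simp) (by compute_degree!) hodd
    simp only [Polynomial.eval_add, Polynomial.eval_pow, Polynomial.eval_X, Polynomial.eval_C]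
      at huv
    have hs0 : s ≠ 0 := fun h => h2 (by rw [← hs, h, zero_mul])
    -- Completing squares turns the conic into `u² + v² + 2 = 0`.
    refine ⟨(v + 1) / s, (u - v) / 2, ?_⟩
    field_simp
    grind

/-! ### Points of the projective line and singular matrices -/

/-- The rows that vanish against a matrix with columns in a given line of the plane. -/
def KillsRow {F : Type*} [CommRing F] : Option F → Matrix (Fin 2) (Fin 2) F → Prop
  | none, M => ∀ j, M 0 j = 0
  | some t, M => ∀ j, t * M 0 j + M 1 j = 0

section KillsRow

variable {F : Type*} [Field F]

theorem killsRow_zero (o : Option F) : KillsRow o 0 := by cases o <;> simp [KillsRow]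

theorem KillsRow.add {o : Option F} {M M' : Matrix (Fin 2) (Fin 2) F} (h : KillsRow o M)
    (h' : KillsRow o M') : KillsRow o (M + M') := by
  cases o with
  | none => intro j; simp [h j, h' j]
  | some t => intro j; simp only [Matrix.add_apply]; linear_combination h j + h' j

theorem KillsRow.mul {o : Option F} {M : Matrix (Fin 2) (Fin 2) F} (h : KillsRow o M)
    (M' : Matrix (Fin 2) (Fin 2) F) : KillsRow o (M * M') := by
  cases o with
  | none => intro j; simp [Matrix.mul_apply, h 0, h 1]
  | some t =>
    intro j
    simp only [Matrix.mul_apply, Fin.sum_univ_two]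
    linear_combination M' 0 j * h 0 + M' 1 j * h 1

theorem not_killsRow_one (o : Option F) : ¬ KillsRow o 1 := by
  cases o with
  | none => intro h; simpa using h 0
  | some t => intro h; simpa using h 1

theorem exists_killsRow_ne_zero (o : Option F) : ∃ M, KillsRow o M ∧ M ≠ 0 := by
  cases o with
  | none =>
    refine ⟨!![0, 0; 1, 0], fun j => by fin_cases j <;> simp, fun h => ?_⟩
    simpa using congrFun (congrFun h 1) 0
  | some t =>
    refine ⟨!![1, 0; -t, 0], fun j => by fin_cases j <;> simp, fun h => ?_⟩
    simpa using congrFun (congrFun h 0) 0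

theorem existsUnique_killsRow {M : Matrix (Fin 2) (Fin 2) F} (hd : M.det = 0) (h0 : M ≠ 0) :
    ∃! o, KillsRow o M := by
  rw [Matrix.det_fin_two] at hd
  by_cases hr : ∀ j, M 0 j = 0
  · refine ⟨none, hr, fun o ho => ?_⟩
    cases o with
    | none => rfl
    | some t =>
      refine absurd ?_ h0
      ext i j
      have := ho j
      rw [hr j, mul_zero, zero_add] at this
      fin_cases i
      · exact hr j
      · exact this
  · push Not at hr
    obtain ⟨j, hj⟩ := hr
    -- `none` is the row `(1, 0)` and `some t` is the row `(t, 1)`. A singular nonzero matrix has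
    -- rank one, so its left kernel is a single such point.
    refine ⟨some (-(M 1 j / M 0 j)), fun k => ?_, fun o ho => ?_⟩
    · field_simp
      fin_cases j <;> fin_cases k <;> simp at * <;> grind
    · cases o with
      | none => exact absurd (ho j) hj
      | some t =>
        congr 1
        have := ho j
        field_simp
        linear_combination this

end KillsRow

end Cubian

/-! ### Finiteness of the counts and Hecke relations -/

namespace Cubian

theorem sum_doubledCoords_sq (x : Cubian) :
    ∑ k, doubledCoords x k ^ 2 = 4 * ((nrd x).re - (nrd x).im) := by
  have h := four_mul_nrd x
  have h1 := congrArg Zsqrtd.re h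
  have h2 := congrArg Zsqrtd.im h
  rw [show (4 : ZSqrtTwo) = ((4 : ℤ) : ZSqrtTwo) by norm_num, Zsqrtd.re_smul] at h1
  rw [show (4 : ZSqrtTwo) = ((4 : ℤ) : ZSqrtTwo) by norm_num, Zsqrtd.im_smul] at h2
  rw [mul_sub, h1, h2, Fin.sum_univ_eight]
  simp only [doubledCoords, Matrix.cons_val]
  simp only [sq, Zsqrtd.re_add, Zsqrtd.im_add, Zsqrtd.re_mul, Zsqrtd.im_mul]
  ring

theorem doubledCoords_injective : Function.Injective doubledCoords := by
  intro x y h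
  have h' := congrFun h
  have e0 := h' 0
  have e1 := h' 1
  have e2 := h' 2
  have e3 := h' 3
  have e4 := h' 4
  have e5 := h' 5
  have e6 := h' 6
  have e7 := h' 7
  simp only [doubledCoords, Matrix.cons_val] at e0 e1 e2 e3 e4 e5 e6 e7
  simp at e0 e1 e2 e3 e4 e5 e6 e7
  ext <;> linarith

/-- The set of cubians of reduced norm `a`. -/
def sols (a : ZSqrtTwo) : Set Cubian := {x | nrd x = a}

theorem mem_sols {a : ZSqrtTwo} {x : Cubian} : x ∈ sols a ↔ nrd x = a := Iff.rfl

theorem sols_finite (a : ZSqrtTwo) : (sols a).Finite := by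
  refine Set.Finite.of_finite_image (f := doubledCoords) ?_ doubledCoords_injective.injOn
  set m := 4 * (a.re - a.im) with hm
  refine (Set.finite_Icc (fun _ : Fin 8 => -m) (fun _ => m)).subset ?_
  rintro _ ⟨x, hx, rfl⟩
  have h : ∑ k, doubledCoords x k ^ 2 = m := by rw [sum_doubledCoords_sq, mem_sols.1 hx]
  have h1 (k) : doubledCoords x k ^ 2 ≤ m := h ▸ Finset.single_le_sum
    (f := fun k => doubledCoords x k ^ 2) (fun k _ => sq_nonneg _) (Finset.mem_univ k)
  exact ⟨fun k => neg_le.1 ((Int.le_self_sq _).trans (by rw [neg_sq]; exact h1 k)),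
    fun k => (Int.le_self_sq _).trans (h1 k)⟩

/-- The number of cubians of reduced norm `a`. -/
noncomputable def rep (a : ZSqrtTwo) : ℕ := (sols a).ncard

theorem totPos_nrd {x : Cubian} (hx : x ≠ 0) : TotPos (nrd x) := by
  have h : nrd x ≠ 0 := fun h => hx (nrd_eq_zero.1 h)
  have h1 : 0 < (nrd x).norm := (nrd_norm_nonneg x).lt_of_ne'
    fun h' => h ((norm_eq_zero_iff_eq_zero _).1 h')
  have h2 : emb (nrd x) * emb' (nrd x) ≠ 0 := by
    rw [emb_mul_emb']; exact_mod_cast h1.ne'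
  exact ⟨(map_nrd_nonneg emb x).lt_of_ne' (left_ne_zero_of_mul h2),
    (map_nrd_nonneg emb' x).lt_of_ne' (right_ne_zero_of_mul h2)⟩

theorem scalar_inv_mul (u : ZSqrtTwoˣ) (x : Cubian) :
    scalar (u : ZSqrtTwo) * (scalar ((u⁻¹ : ZSqrtTwoˣ) : ZSqrtTwo) * x) = x := by
  rw [← mul_assoc, ← map_mul, Units.mul_inv, map_one, one_mul]

theorem rep_unit_sq_mul (u : ZSqrtTwoˣ) (a : ZSqrtTwo) : rep ((u : ZSqrtTwo) ^ 2 * a) = rep a := by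
  refine (Set.ncard_congr (fun x _ => scalar (u : ZSqrtTwo) * x) ?_ ?_ ?_).symm
  · intro x hx
    rw [mem_sols] at *
    rw [nrd_mul, nrd_scalar, hx, sq]
  · intro x y _ _ h
    exact scalar_mul_cancel u.ne_zero h
  · intro x hx
    rw [mem_sols] at hx
    refine ⟨scalar ((u⁻¹ : ZSqrtTwoˣ) : ZSqrtTwo) * x, ?_, scalar_inv_mul u x⟩
    rw [mem_sols, nrd_mul, nrd_scalar, hx]
    linear_combination (((u⁻¹ : ZSqrtTwoˣ) : ZSqrtTwo) * u + 1) * a * u.inv_mul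

section Hecke

variable {F : Type*} [Field F] (f : ZSqrtTwo →+* F) {x z : F}
  (h : z ^ 2 + f rt * x * z + x ^ 2 - z - f rt * x + 1 = 0)

/-- The right ideal of all cubians whose matrices have columns in a given line. -/
def lineIdeal (o : Option F) : AddSubgroup Cubian where
  carrier := {q | KillsRow o (toMat f x z q)}
  zero_mem' := by
    have : toMat f x z 0 = 0 := by simpa using toMat_scalar f (x := x) (z := z) 0
    simpa [this] using killsRow_zero o
  add_mem' := by
    intro p q hp hq
    simpa [toMat_add] using hp.add hq
  neg_mem' := by
    intro p hp
    have : toMat f x z (-p) = toMat f x z p * (-1) := by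
      ext i j
      fin_cases i <;> fin_cases j <;> simp [toMat] <;> ring
    simpa [this] using KillsRow.mul hp (-1)

theorem mem_lineIdeal {o : Option F} {q : Cubian} :
    q ∈ lineIdeal f (x := x) (z := z) o ↔ KillsRow o (toMat f x z q) := Iff.rfl

variable (hf : Function.Surjective f) {π : ZSqrtTwo} (hπ : Prime π) (hker : ∀ a, f a = 0 ↔ π ∣ a)

include h hker in
theorem toMat_eq_zero_iff {q : Cubian} : toMat f x z q = 0 ↔ ∃ y, q = scalar π * y := by
  constructor
  · intro hq
    obtain ⟨h0, h1, h2, h3⟩ := toMat_eq_zero f h hq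
    obtain ⟨y0, h0⟩ := (hker _).1 h0
    obtain ⟨y1, h1⟩ := (hker _).1 h1
    obtain ⟨y2, h2⟩ := (hker _).1 h2
    obtain ⟨y3, h3⟩ := (hker _).1 h3
    exact ⟨⟨y0, y1, y2, y3⟩, by rw [scalar_mul]; exact Cubian.ext h0 h1 h2 h3⟩
  · rintro ⟨y, rfl⟩
    rw [toMat_mul f h, toMat_scalar, (hker π).2 dvd_rfl, zero_smul, zero_mul]

-- The ideal of a line contains `π`, so its generator has norm dividing `π²`. A unit norm would make
-- the ideal everything, and norm `π²` up to a unit would make it the multiples of `π`; both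
-- contradict the shape of the ideal modulo `π`. The remaining unit factor is totally positive,
-- hence a square, and is absorbed by a scalar.
include h hf hπ hker in
theorem exists_lineIdeal_generator (hpos : TotPos π) (o : Option F) :
    ∃ ρ, nrd ρ = π ∧ ∀ q, KillsRow o (toMat f x z q) ↔ ∃ y, q = ρ * y := by
  have hJ : ∀ p ∈ lineIdeal f (x := x) (z := z) o, ∀ q,
      p * q ∈ lineIdeal f (x := x) (z := z) o := by
    intro p hp q
    rw [mem_lineIdeal, toMat_mul f h]
    exact KillsRow.mul hp _
  obtain ⟨ρ, hρ, hgen⟩ := exists_right_ideal_generator (fun q => (nrd q).norm.natAbs) division _ hJ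
  have hmemπ : scalar π ∈ lineIdeal f (x := x) (z := z) o := by
    rw [mem_lineIdeal, (toMat_eq_zero_iff f h hker).2 ⟨1, by rw [mul_one]⟩]
    exact killsRow_zero o
  obtain ⟨y, hy⟩ := hgen _ hmemπ
  have hn : nrd ρ * nrd y = π ^ 2 := by rw [← nrd_mul, ← hy, nrd_scalar, sq]
  obtain ⟨i, hi, hass⟩ := (dvd_prime_pow hπ 2).1 ⟨_, hn.symm⟩
  interval_cases i
  · exfalso
    rw [pow_zero, associated_one_iff_isUnit] at hass
    obtain ⟨u, hu⟩ := hass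
    have h1 : (1 : Cubian) ∈ lineIdeal f (x := x) (z := z) o := by
      have := hJ _ hρ (conj ρ * scalar ((u⁻¹ : ZSqrtTwoˣ) : ZSqrtTwo))
      rwa [← mul_assoc, mul_conj, ← hu, ← map_mul, Units.mul_inv, map_one] at this
    rw [mem_lineIdeal, ← map_one scalar, toMat_scalar, map_one, one_smul] at h1
    exact not_killsRow_one o h1
  · rw [pow_one] at hass
    obtain ⟨u, hu⟩ := hass
    have hρ0 : ρ ≠ 0 := by
      rintro rfl
      rw [nrd_zero, zero_mul] at hn
      exact pow_ne_zero 2 hπ.ne_zero hn.symm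
    have hu' : TotPos (u : ZSqrtTwo) := by
      refine TotPos.of_mul_left (a := nrd ρ) ?_ (totPos_nrd hρ0)
      rwa [hu]
    obtain ⟨b, hb⟩ := hu'.isSquare_of_isUnit u.isUnit
    refine ⟨ρ * scalar (b : ZSqrtTwo), ?_, fun q => ⟨fun hq => ?_, ?_⟩⟩
    · rw [nrd_mul, nrd_scalar, ← sq, ← hb, hu]
    · obtain ⟨t, ht⟩ := hgen q hq
      exact ⟨scalar ((b⁻¹ : ZSqrtTwoˣ) : ZSqrtTwo) * t, by rw [mul_assoc, scalar_inv_mul, ht]⟩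
    · rintro ⟨t, rfl⟩
      rw [mul_assoc]
      exact hJ _ hρ _
  · exfalso
    obtain ⟨u, hu⟩ := hass.symm
    have hyu : (u : ZSqrtTwo) * nrd y = 1 := by
      apply mul_left_cancel₀ (pow_ne_zero 2 hπ.ne_zero)
      rw [← mul_assoc, hu, hn, mul_one]
    have hρ' : ρ = scalar π * (conj y * scalar (u : ZSqrtTwo)) := by
      rw [hy, mul_assoc, ← mul_assoc y, mul_conj, ← map_mul, mul_comm, hyu, map_one, mul_one]
    obtain ⟨M, hM, hM0⟩ := exists_killsRow_ne_zero o
    obtain ⟨q, rfl⟩ := toMat_surjective f h hf M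
    obtain ⟨t, rfl⟩ := hgen q hM
    refine hM0 ((toMat_eq_zero_iff f h hker).2 ⟨conj y * scalar (u : ZSqrtTwo) * t, ?_⟩)
    rw [← mul_assoc, ← hρ']

include hf hπ hker in
/-- The Hecke relation, with the multiples of `π` counted separately. -/
theorem rep_mul_add [Fintype F] (hpos : TotPos π) (a : ZSqrtTwo) :
    rep (π * a) + Fintype.card F * {q ∈ sols (π * a) | ∃ y, q = scalar π * y}.ncard
      = (Fintype.card F + 1) * rep a := by
  classical
  obtain ⟨x, z, h⟩ := exists_conic_point (f rt) (map_rt_sq f)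
  set S := (sols_finite (π * a)).toFinset with hS
  -- For a fixed point, the cubians counted are `ρ * y` with `nrd y = a`.
  have hcount (o : Option F) : (S.filter fun q => KillsRow o (toMat f x z q)).card = rep a := by
    obtain ⟨ρ, hρ, hρ'⟩ := exists_lineIdeal_generator f h hf hπ hker hpos o
    have hρc (p q : Cubian) (hpq : ρ * p = ρ * q) : p = q := by
      apply scalar_mul_cancel hπ.ne_zero
      rw [← hρ, ← conj_mul_self, mul_assoc, mul_assoc, hpq]
    rw [← Set.ncard_coe_finset, rep]
    refine (Set.ncard_congr (fun y _ => ρ * y) ?_ ?_ ?_).symm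
    · intro y hy
      rw [mem_sols] at hy
      simp [hS, mem_sols, hρ, hy, hρ']
    · intro p q _ _ hpq
      exact hρc p q hpq
    · intro q hq
      simp only [hS, Finset.coe_filter, Set.Finite.mem_toFinset, mem_sols, hρ', Set.mem_ofPred_eq]
        at hq
      obtain ⟨hq, y, rfl⟩ := hq
      refine ⟨y, ?_, rfl⟩
      rw [nrd_mul, hρ] at hq
      exact mul_left_cancel₀ hπ.ne_zero hq
  -- For a fixed `q`, the matrix is singular: rank one gives one point, and the zero matrix, when
  -- `π` divides `q`, gives all `|F| + 1`.
  have hfib (q) (hq : q ∈ S) : (Finset.univ.filter fun o => KillsRow o (toMat f x z q)).card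
      = 1 + if (∃ y, q = scalar π * y) then Fintype.card F else 0 := by
    split_ifs with hy
    · rw [(toMat_eq_zero_iff f h hker).2 hy]
      simp [killsRow_zero, add_comm]
    · rw [← toMat_eq_zero_iff f h hker] at hy
      have hd : (toMat f x z q).det = 0 := by
        rw [det_toMat f h, hker]
        simp only [hS, Set.Finite.mem_toFinset, mem_sols] at hq
        exact ⟨a, hq⟩
      obtain ⟨o, ho, huniq⟩ := existsUnique_killsRow hd hy
      rw [Finset.card_eq_one.2 ⟨o, ?_⟩]
      ext o'
      simp only [Finset.mem_filter, Finset.mem_univ, true_and, Finset.mem_singleton]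
      exact ⟨huniq o', fun e => e ▸ ho⟩
  have h1 := Finset.sum_card_bipartiteAbove_eq_sum_card_bipartiteBelow
    (s := S) (t := (Finset.univ : Finset (Option F))) (fun q o => KillsRow o (toMat f x z q))
  simp only [Finset.bipartiteAbove, Finset.bipartiteBelow, hcount] at h1
  rw [Finset.sum_congr rfl hfib, Finset.sum_add_distrib, ← Finset.sum_filter] at h1
  simp only [Finset.sum_const, smul_eq_mul, mul_one, Finset.card_univ, Fintype.card_option] at h1
  rw [← h1, rep, ← Set.ncard_coe_finset S, ← Set.ncard_coe_finset (S.filter _)]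
  simp [hS, mul_comm]

include hf hπ hker in
theorem rep_mul_of_not_dvd [Fintype F] (hpos : TotPos π) {a : ZSqrtTwo} (ha : ¬ π ∣ a) :
    rep (π * a) = (Fintype.card F + 1) * rep a := by
  rw [← rep_mul_add f hf hπ hker hpos a]
  have : {q ∈ sols (π * a) | ∃ y, q = scalar π * y} = ∅ := by
    refine Set.eq_empty_of_forall_notMem ?_
    rintro _ ⟨hq, y, rfl⟩
    rw [mem_sols, nrd_mul, nrd_scalar, mul_assoc] at hq
    exact ha ⟨_, (mul_left_cancel₀ hπ.ne_zero hq).symm⟩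
  rw [this, Set.ncard_empty, mul_zero, add_zero]

include hf hπ hker in
theorem rep_mul_mul [Fintype F] (hpos : TotPos π) (a : ZSqrtTwo) :
    rep (π * (π * a)) + Fintype.card F * rep a = (Fintype.card F + 1) * rep (π * a) := by
  rw [← rep_mul_add f hf hπ hker hpos (π * a)]
  congr 2
  refine Set.ncard_congr (fun y _ => scalar π * y) ?_ ?_ ?_
  · intro y hy
    rw [mem_sols] at hy
    exact ⟨by rw [mem_sols, nrd_mul, nrd_scalar, hy, mul_assoc], y, rfl⟩
  · intro p q _ _ hpq
    exact scalar_mul_cancel hπ.ne_zero hpq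
  · rintro _ ⟨hq, y, rfl⟩
    refine ⟨y, ?_, rfl⟩
    rw [mem_sols, nrd_mul, nrd_scalar, mul_assoc] at hq
    exact mul_left_cancel₀ hπ.ne_zero (mul_left_cancel₀ hπ.ne_zero hq)

end Hecke

end Cubian

/-! ### The 48 cubians of reduced norm 1 -/

namespace Cubian

/-- The pairs `(a, b)` for which `a + b √2` can occur among twice the quaternion coordinates of a
cubian of reduced norm `1`. -/
def unitCoordPairs : Finset (ℤ × ℤ) :=
  {(0, 0), (1, 0), (-1, 0), (2, 0), (-2, 0), (0, 1), (0, -1), (1, 1), (1, -1), (-1, 1), (-1, -1)}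

theorem mem_unitCoordPairs {a b : ℤ} (h : a ^ 2 + 2 * b ^ 2 ≤ 4) : (a, b) ∈ unitCoordPairs := by
  have h1 : a ≤ 2 := by nlinarith
  have h2 : -2 ≤ a := by nlinarith
  have h3 : b ≤ 1 := by nlinarith
  have h4 : -1 ≤ b := by nlinarith
  interval_cases a <;> interval_cases b <;> first | decide | omega

/-- The condition on the pairs `(a, b)` for the numbers `a + b √2` to be twice the quaternion
coordinates of a cubian of reduced norm `1`. -/
def IsUnitCoords (p : ((ℤ × ℤ) × (ℤ × ℤ)) × ((ℤ × ℤ) × (ℤ × ℤ))) : Prop :=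
  p.1.1.1 ^ 2 + p.1.2.1 ^ 2 + p.2.1.1 ^ 2 + p.2.2.1 ^ 2
    + 2 * (p.1.1.2 ^ 2 + p.1.2.2 ^ 2 + p.2.1.2 ^ 2 + p.2.2.2 ^ 2) = 4 ∧
  p.1.1.1 * p.1.1.2 + p.1.2.1 * p.1.2.2 + p.2.1.1 * p.2.1.2 + p.2.2.1 * p.2.2.2 = 0 ∧
  (p.1.1.1 - p.1.2.1) % 2 = 0 ∧ (p.1.1.1 - p.2.1.1) % 2 = 0 ∧ (p.1.1.1 - p.2.2.1) % 2 = 0 ∧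
  (p.1.1.2 + p.1.2.2 + p.2.1.2 + p.2.2.2) % 2 = 0

instance : DecidablePred IsUnitCoords := fun _ => inferInstanceAs (Decidable (_ ∧ _))

theorem card_unitCoords : (((unitCoordPairs ×ˢ unitCoordPairs) ×ˢ
    (unitCoordPairs ×ˢ unitCoordPairs)).filter IsUnitCoords).card = 48 := by
  decide +kernel

-- Doubled quaternion coordinates `a + b√2` have squares summing to 4. Comparing rational and
-- irrational parts bounds each pair and leaves a finite enumeration with the parity conditions of
-- the order.
set_option maxRecDepth 2000 in
theorem rep_one : rep 1 = 48 := by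
  rw [← card_unitCoords, rep, ← Set.ncard_coe_finset]
  let g (r : ZSqrtTwo) : ℤ × ℤ := (r.re, r.im)
  have hg : Function.Injective g := fun r r' h => by
    simp only [g, Prod.mk.injEq] at h
    exact Zsqrtd.ext h.1 h.2
  refine Set.ncard_congr (fun x _ => ((g (2 * x.c0 + rt * x.c1 + rt * x.c2 + x.c3),
    g (rt * x.c1 + x.c3)), (g (rt * x.c2 + x.c3), g x.c3))) ?_ ?_ ?_
  · intro x hx
    have h := four_mul_nrd x
    rw [mem_sols.1 hx] at h
    simp only [Finset.coe_filter, Finset.mem_product, Set.mem_ofPred_eq, IsUnitCoords, g]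
    have p1 : ((2 * x.c0 + rt * x.c1 + rt * x.c2 + x.c3).re - (rt * x.c1 + x.c3).re) % 2 = 0 := by
      simp
    have p2 : ((2 * x.c0 + rt * x.c1 + rt * x.c2 + x.c3).re - (rt * x.c2 + x.c3).re) % 2 = 0 := by
      simp
    have p3 : ((2 * x.c0 + rt * x.c1 + rt * x.c2 + x.c3).re - x.c3.re) % 2 = 0 := by
      simp
    have p4 : ((2 * x.c0 + rt * x.c1 + rt * x.c2 + x.c3).im + (rt * x.c1 + x.c3).im +
      (rt * x.c2 + x.c3).im + x.c3.im) % 2 = 0 := by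
      simp; omega
    generalize 2 * x.c0 + rt * x.c1 + rt * x.c2 + x.c3 = t at *
    generalize rt * x.c1 + x.c3 = u at *
    generalize rt * x.c2 + x.c3 = v at *
    generalize x.c3 = w at *
    have h1 := congrArg Zsqrtd.re h
    have h2 := congrArg Zsqrtd.im h
    simp only [sq, mul_one, Zsqrtd.re_add, Zsqrtd.im_add, Zsqrtd.re_mul, Zsqrtd.im_mul,
      Zsqrtd.re_ofNat, Zsqrtd.im_ofNat, Nat.cast_ofNat] at h1 h2
    refine ⟨⟨⟨mem_unitCoordPairs ?_, mem_unitCoordPairs ?_⟩,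
      mem_unitCoordPairs ?_, mem_unitCoordPairs ?_⟩, ?_, ?_, p1, p2, p3, p4⟩
    · nlinarith only [h1, sq_nonneg u.re, sq_nonneg u.im, sq_nonneg v.re, sq_nonneg v.im,
        sq_nonneg w.re, sq_nonneg w.im]
    · nlinarith only [h1, sq_nonneg t.re, sq_nonneg t.im, sq_nonneg v.re, sq_nonneg v.im,
        sq_nonneg w.re, sq_nonneg w.im]
    · nlinarith only [h1, sq_nonneg u.re, sq_nonneg u.im, sq_nonneg t.re, sq_nonneg t.im,
        sq_nonneg w.re, sq_nonneg w.im]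
    · nlinarith only [h1, sq_nonneg u.re, sq_nonneg u.im, sq_nonneg v.re, sq_nonneg v.im,
        sq_nonneg t.re, sq_nonneg t.im]
    · linarith
    · linarith
  · intro x y _ _ h
    simp only [Prod.mk.injEq, hg.eq_iff] at h
    obtain ⟨⟨h0, h1⟩, h2, h3⟩ := h
    have hrt : rt ≠ 0 := by decide
    have h1' : x.c1 = y.c1 := mul_left_cancel₀ hrt (by linear_combination h1 - h3)
    have h2' : x.c2 = y.c2 := mul_left_cancel₀ hrt (by linear_combination h2 - h3)
    refine Cubian.ext ?_ h1' h2' h3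
    refine mul_left_cancel₀ (show (2 : ZSqrtTwo) ≠ 0 by decide) ?_
    linear_combination h0 - h1 - h2 + h3
  · rintro ⟨⟨⟨a0, b0⟩, a1, b1⟩, ⟨a2, b2⟩, a3, b3⟩ hp
    simp only [Finset.coe_filter, Finset.mem_product, Set.mem_ofPred_eq, IsUnitCoords] at hp
    obtain ⟨-, h1, h2, h3, h4, h5, h6⟩ := hp
    obtain ⟨k1, h3⟩ := Int.dvd_of_emod_eq_zero h3
    obtain ⟨k2, h4⟩ := Int.dvd_of_emod_eq_zero h4
    obtain ⟨k3, h5⟩ := Int.dvd_of_emod_eq_zero h5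
    obtain ⟨k4, h6⟩ := Int.dvd_of_emod_eq_zero h6
    have e0 : 2 * (⟨k1 + k2 - k3, k4 - b1 - b2⟩ : ZSqrtTwo) + rt * ⟨b1 - b3, k3 - k1⟩
        + rt * ⟨b2 - b3, k3 - k2⟩ + ⟨a3, b3⟩ = ⟨a0, b0⟩ := by
      ext <;> simp <;> linarith
    have e1 : rt * (⟨b1 - b3, k3 - k1⟩ : ZSqrtTwo) + ⟨a3, b3⟩ = ⟨a1, b1⟩ := by
      ext
      · simp
        linarith
      · simp
    have e2 : rt * (⟨b2 - b3, k3 - k2⟩ : ZSqrtTwo) + ⟨a3, b3⟩ = ⟨a2, b2⟩ := by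
      ext
      · simp
        linarith
      · simp
    refine ⟨⟨⟨k1 + k2 - k3, k4 - b1 - b2⟩, ⟨b1 - b3, k3 - k1⟩, ⟨b2 - b3, k3 - k2⟩, ⟨a3, b3⟩⟩,
      ?_, ?_⟩
    · rw [mem_sols]
      apply mul_left_cancel₀ (show (4 : ZSqrtTwo) ≠ 0 by decide)
      rw [four_mul_nrd]
      simp only [e0, e1, e2]
      ext <;> simp [sq] <;> linarith
    · simp only [e0, e1, e2, g]

end Cubian

/-! ### The suborder as an Eichler order of level 4 -/

namespace Cubian

/-- The first coordinate of the action of a cubian on a primitive vector modulo `4`. -/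
def coordA (q : Cubian) : ZSqrtTwo := q.c0 - q.c2 + (1 + 2 * rt) * q.c3

/-- The second coordinate of the action of a cubian on a primitive vector modulo `4`. -/
def coordB (q : Cubian) : ZSqrtTwo := q.c1 - (1 + 2 * rt) * q.c2 - (1 + rt) * q.c3

/-- The lower right entry of the action of a cubian modulo `4`. -/
def lowerRight (u : Cubian) : ZSqrtTwo := u.c0 + rt * u.c1 + (1 + rt) * u.c2 - 2 * rt * u.c3

/-- `coordA` and `coordB` form the first column of `toMat` at the point `x = -1`, `z = -(1 + 2√2)`,
which lies on the conic modulo 4. Modulo 4 these formulas are therefore matrix multiplication; the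
last term is the exact correction. -/
theorem coordA_mul (u q : Cubian) : coordA (u * q) = coordA u * coordA q
    + (-u.c1 - (2 + 3 * rt) * u.c2 - (1 + rt) * u.c3) * coordB q
    + 4 * (u.c1 * q.c3 - (4 + 2 * rt) * (u.c2 * q.c2) - (2 + rt) * (u.c2 * q.c3)
      - (3 + rt) * (u.c3 * q.c3)) := by
  have h := rt_sq
  simp only [coordA, coordB, mul_c0, mul_c2, mul_c3]
  generalize rt = s at *
  grind

theorem coordB_mul (u q : Cubian) : coordB (u * q) = coordB u * coordA q + lowerRight u * coordB q
    + 4 * (u.c1 * q.c2 - u.c2 * q.c1 + (3 + rt) * (u.c2 * q.c3 - u.c3 * q.c2)) := by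
  have h := rt_sq
  simp only [coordA, coordB, lowerRight, mul_c1, mul_c2, mul_c3]
  generalize rt = s at *
  grind

/-- A totally positive generator of the prime ideal above `2`. -/
def rtPos : ZSqrtTwo := 2 + rt

theorem rtPos_pow_four : rtPos ^ 4 = 4 * ⟨17, 12⟩ := by decide

theorem rtPos_dvd (a : ZSqrtTwo) : rtPos ^ 1 ∣ a ↔ 2 ∣ a.re := by
  constructor
  · rintro ⟨y, rfl⟩
    simp [rtPos]
  · rintro ⟨p, hp⟩
    exact ⟨⟨2 * p - a.im, a.im - p⟩, by ext <;> simp [rtPos] <;> omega⟩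

theorem rtPos_sq_dvd (a : ZSqrtTwo) : rtPos ^ 2 ∣ a ↔ 2 ∣ a.re ∧ 2 ∣ a.im := by
  rw [show rtPos ^ 2 = ⟨6, 4⟩ by decide]
  constructor
  · rintro ⟨y, rfl⟩
    simp; omega
  · rintro ⟨⟨p, hp⟩, q, hq⟩
    exact ⟨⟨3 * p - 4 * q, 3 * q - 2 * p⟩, by ext <;> simp <;> omega⟩

theorem rtPos_pow_three_dvd (a : ZSqrtTwo) : rtPos ^ 3 ∣ a ↔ 4 ∣ a.re ∧ 2 ∣ a.im := by
  rw [show rtPos ^ 3 = ⟨20, 14⟩ by decide]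
  constructor
  · rintro ⟨y, rfl⟩
    simp; omega
  · rintro ⟨⟨p, hp⟩, q, hq⟩
    exact ⟨⟨10 * p - 7 * q, 5 * q - 7 * p⟩, by ext <;> simp <;> omega⟩

theorem four_dvd_iff (a : ZSqrtTwo) : 4 ∣ a ↔ 4 ∣ a.re ∧ 4 ∣ a.im := by
  constructor
  · rintro ⟨y, rfl⟩
    simp
  · rintro ⟨⟨p, hp⟩, q, hq⟩
    exact ⟨⟨p, q⟩, by ext <;> simp <;> omega⟩

theorem rtPos_pow_four_dvd (a : ZSqrtTwo) : rtPos ^ 4 ∣ a ↔ 4 ∣ a := by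
  have hu : IsUnit (⟨17, 12⟩ : ZSqrtTwo) := IsUnit.of_mul_eq_one ⟨17, -12⟩ (by decide)
  rw [rtPos_pow_four, hu.mul_right_dvd]

/-- Representatives modulo `±1` for the cubians of reduced norm `1`. -/
def unitRep : Fin 24 → Cubian :=
  ![⟨-1, 0, 0, 0⟩, ⟨0, 0, 0, -1⟩,
    ⟨1, -rt, -rt, 1⟩, ⟨-1, 0, rt, -1⟩,
    ⟨0, -rt, 0, 1⟩, ⟨-1, rt, 0, -1⟩,
    ⟨0, 0, -rt, 1⟩, ⟨-2, rt, rt, -1⟩,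
    ⟨-1, 0, 0, 1⟩, ⟨0, -1, 0, 0⟩,
    ⟨0, 0, -1, 0⟩, ⟨-rt, 1, 1, -rt⟩,
    ⟨0, -1, -1, rt⟩, ⟨-rt, 0, 1, 0⟩,
    ⟨-rt, 1, 0, 0⟩, ⟨1, -rt, 0, 0⟩,
    ⟨rt, -1, -1, 0⟩, ⟨0, 0, 1, -rt⟩,
    ⟨rt, -2, -1, rt⟩, ⟨0, -1, 1, 0⟩,
    ⟨1, 0, -rt, 0⟩, ⟨0, 1, 0, -rt⟩,
    ⟨rt, -1, -2, rt⟩, ⟨-1, rt, rt, -2⟩]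

theorem nrd_unitRep : ∀ i, nrd (unitRep i) = 1 := by decide +kernel

/-- The membership in the left ideal of all cubians which map the chosen primitive vector into its
multiples by `(√2) ^ k`. -/
def InLevel (k : ℕ) (q : Cubian) : Prop := rtPos ^ k ∣ coordA q ∧ rtPos ^ k ∣ coordB q

/-- The bottom rows of the 24 units represent each point of the projective line over `ℤ[√2]/4` once.
The points killing a column of exact divisibility `ϖ ^ k` number 1, 2, 4, 8 for `k = 0, 1, 2, 3`,
and 24 for the zero column; the coefficients 1, 1, 2, 4, 16 are the successive increments. Only
residues modulo 4 matter, so the check is finite. -/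
theorem card_unitRep_residues : ∀ p q r t : ZMod 4,
    (Finset.univ.filter fun i : Fin 24 =>
      ((coordB (unitRep i)).re : ZMod 4) * p + 2 * (coordB (unitRep i)).im * q
        + (lowerRight (unitRep i)).re * r + 2 * (lowerRight (unitRep i)).im * t = 0 ∧
      ((coordB (unitRep i)).re : ZMod 4) * q + (coordB (unitRep i)).im * p
        + (lowerRight (unitRep i)).re * t + (lowerRight (unitRep i)).im * r = 0).card
    = 1 + (if 2 * p = 0 ∧ 2 * r = 0 then 1 else 0)
      + 2 * (if (2 * p = 0 ∧ 2 * q = 0) ∧ (2 * r = 0 ∧ 2 * t = 0) then 1 else 0)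
      + 4 * (if (p = 0 ∧ 2 * q = 0) ∧ (r = 0 ∧ 2 * t = 0) then 1 else 0)
      + 16 * (if (p = 0 ∧ q = 0) ∧ (r = 0 ∧ t = 0) then 1 else 0) := by
  decide +kernel

theorem four_dvd_iff_cast (n : ℤ) : 4 ∣ n ↔ (n : ZMod 4) = 0 :=
  (ZMod.intCast_zmod_eq_zero_iff_dvd n 4).symm

theorem two_dvd_iff_cast (n : ℤ) : 2 ∣ n ↔ 2 * (n : ZMod 4) = 0 := by
  have := four_dvd_iff_cast (2 * n)
  push_cast at this
  rw [← this]
  omega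

open Classical in
theorem card_unitRep_filter (q : Cubian) :
    (Finset.univ.filter fun i => 4 ∣ coordB (unitRep i * q)).card
    = 1 + (if InLevel 1 q then 1 else 0) + 2 * (if InLevel 2 q then 1 else 0)
      + 4 * (if InLevel 3 q then 1 else 0) + 16 * (if InLevel 4 q then 1 else 0) := by
  have h := card_unitRep_residues (coordA q).re (coordA q).im (coordB q).re (coordB q).im
  simp only [InLevel, rtPos_dvd, rtPos_sq_dvd, rtPos_pow_three_dvd, rtPos_pow_four_dvd,
    four_dvd_iff, four_dvd_iff_cast, two_dvd_iff_cast]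
  convert h using 3
  rename_i i
  rw [← four_dvd_iff_cast, ← four_dvd_iff_cast, ← four_dvd_iff, coordB_mul,
    dvd_add_left (dvd_mul_right (4 : ZSqrtTwo) _), four_dvd_iff, four_dvd_iff_cast,
    four_dvd_iff_cast]
  simp only [Zsqrtd.re_add, Zsqrtd.im_add, Zsqrtd.re_mul, Zsqrtd.im_mul]
  push_cast
  constructor <;> rintro ⟨h1, h2⟩ <;> constructor <;>
    first | linear_combination h1 | linear_combination h2

/-- Generators of the left ideals `InLevel k`. -/
def levelGen : ℕ → Cubian
  | 1 => ⟨0, 0, 1, 1⟩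
  | 2 => ⟨1 + rt, -1, 0, 1 + rt⟩
  | 3 => ⟨1 + rt, 1 + rt, 1 + rt, 0⟩
  | 4 => ⟨5 + 4 * rt, 1 + rt, -2 - rt, 1 + rt⟩
  | _ => 1

theorem nrd_levelGen {k : ℕ} (hk : k ≤ 4) : nrd (levelGen k) = rtPos ^ k := by
  interval_cases k <;> decide

theorem inLevel_levelGen {k : ℕ} (hk : k ≤ 4) : InLevel k (levelGen k) := by
  interval_cases k
  · simp [InLevel]
  · exact ⟨(rtPos_dvd _).2 (by decide), (rtPos_dvd _).2 (by decide)⟩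
  · exact ⟨(rtPos_sq_dvd _).2 (by decide), (rtPos_sq_dvd _).2 (by decide)⟩
  · exact ⟨(rtPos_pow_three_dvd _).2 (by decide), (rtPos_pow_three_dvd _).2 (by decide)⟩
  · exact ⟨(rtPos_pow_four_dvd _).2 ((four_dvd_iff _).2 (by decide)),
      (rtPos_pow_four_dvd _).2 ((four_dvd_iff _).2 (by decide))⟩

theorem InLevel.mul_left {k : ℕ} (hk : k ≤ 4) (u : Cubian) {q : Cubian} (hq : InLevel k q) :
    InLevel k (u * q) := by
  have h4 : rtPos ^ k ∣ 4 :=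
    (pow_dvd_pow _ hk).trans ((rtPos_pow_four_dvd 4).2 dvd_rfl)
  rw [InLevel, coordA_mul, coordB_mul]
  exact ⟨dvd_add (dvd_add (hq.1.mul_left _) (hq.2.mul_left _)) (h4.mul_right _),
    dvd_add (dvd_add (hq.1.mul_left _) (hq.2.mul_left _)) (h4.mul_right _)⟩

/-- The quotient is `q * conj (levelGen k)` divided by `ϖ ^ k`; it is integral once `c0` and `c1`
are expressed through the two divisibility conditions. -/
theorem InLevel.exists_mul_levelGen {k : ℕ} (hk : k ≤ 4) {q : Cubian} (hq : InLevel k q) :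
    ∃ y, q = y * levelGen k := by
  obtain ⟨⟨t, ht⟩, v, hv⟩ := hq
  have h := rt_sq
  have h0 : q.c0 = rtPos ^ k * t + q.c2 - (1 + 2 * rt) * q.c3 := by
    rw [← ht, coordA]; ring
  have h1 : q.c1 = rtPos ^ k * v + (1 + 2 * rt) * q.c2 + (1 + rt) * q.c3 := by
    rw [← hv, coordB]; ring
  clear ht hv
  obtain ⟨a, b, c, d⟩ := q
  simp only at h0 h1
  subst h0 h1
  interval_cases k
  · exact ⟨_, (mul_one _).symm⟩
  · refine ⟨⟨(1 + 1 * rt) * t + (0 + 1 * rt) * c + (-1 - 1 * rt) * d,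
      (1 + 1 * rt) * v + (1 + 1 * rt) * c + 2 * d,
      -1 * t + 1 * v + (-2 + 2 * rt) * c + (-1 + 2 * rt) * d,
      -1 * t + (-1 - 1 * rt) * v + -3 * c + (-2 + 1 * rt) * d⟩, ?_⟩
    ext1 <;> simp only [mul_c0, mul_c1, mul_c2, mul_c3, levelGen, rtPos] <;>
      generalize rt = s at * <;> grind
  · refine ⟨⟨(2 + 1 * rt) * t + -1 * v + (3 - 2 * rt) * c + (3 - 3 * rt) * d,
      1 * t + (2 + 2 * rt) * v + (3 - 1 * rt) * c + (5 - 3 * rt) * d,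
      (1 + 1 * rt) * v + 1 * c + (2 - 1 * rt) * d,
      (-1 - 1 * rt) * t + (-2 - 1 * rt) * v + (0 - 1 * rt) * c + (3 - 2 * rt) * d⟩, ?_⟩
    ext1 <;> simp only [mul_c0, mul_c1, mul_c2, mul_c3, levelGen, rtPos] <;>
      generalize rt = s at * <;> grind
  · refine ⟨⟨(5 + 3 * rt) * t + (1 + 1 * rt) * v + (2 - 1 * rt) * c + (5 - 4 * rt) * d,
      (-1 - 1 * rt) * t + (3 + 2 * rt) * v + (-1 + 1 * rt) * c + (2 - 1 * rt) * d,
      (-1 - 1 * rt) * t + (3 - 2 * rt) * d,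
      (-1 - 1 * rt) * v + (-3 + 2 * rt) * c⟩, ?_⟩
    ext1 <;> simp only [mul_c0, mul_c1, mul_c2, mul_c3, levelGen, rtPos] <;>
      generalize rt = s at * <;> grind
  · refine ⟨⟨(6 + 4 * rt) * t + (1 + 1 * rt) * v + (3 - 2 * rt) * c + (4 - 3 * rt) * d,
      (-1 - 1 * rt) * t + (4 + 3 * rt) * v + (3 - 2 * rt) * c + (3 - 2 * rt) * d,
      (2 + 1 * rt) * t + (1 + 1 * rt) * v + (3 - 2 * rt) * c + (7 - 5 * rt) * d,
      (-1 - 1 * rt) * t + (3 - 2 * rt) * d⟩, ?_⟩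
    ext1 <;> simp only [mul_c0, mul_c1, mul_c2, mul_c3, levelGen, rtPos] <;>
      generalize rt = s at * <;> grind

theorem ncard_sols_inLevel {k : ℕ} (hk : k ≤ 4) (a : ZSqrtTwo) :
    {q ∈ sols (rtPos ^ k * a) | InLevel k q}.ncard = rep a := by
  have h0 : rtPos ^ k ≠ 0 := pow_ne_zero _ (by decide)
  refine (Set.ncard_congr (fun y _ => y * levelGen k) ?_ ?_ ?_).symm
  · intro y hy
    rw [mem_sols] at hy
    exact ⟨by rw [mem_sols, nrd_mul, hy, nrd_levelGen hk, mul_comm],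
      (inLevel_levelGen hk).mul_left hk y⟩
  · intro x y _ _ hxy
    apply scalar_mul_cancel h0
    rw [scalar_comm, scalar_comm, ← nrd_levelGen hk, ← mul_conj, ← mul_assoc, ← mul_assoc, hxy]
  · rintro q ⟨hq, hl⟩
    obtain ⟨y, rfl⟩ := hl.exists_mul_levelGen hk
    refine ⟨y, ?_, rfl⟩
    rw [mem_sols, nrd_mul, nrd_levelGen hk, mul_comm] at hq
    exact mul_left_cancel₀ h0 hq

theorem ncard_sols_inLevel_of_not_dvd {k : ℕ} (hk : k ≤ 4) {a : ZSqrtTwo} (ha : ¬ rtPos ^ k ∣ a) :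
    {q ∈ sols a | InLevel k q}.ncard = 0 := by
  rw [Set.ncard_eq_zero ((sols_finite a).subset fun _ h => h.1)]
  refine Set.eq_empty_of_forall_notMem ?_
  rintro q ⟨hq, hl⟩
  obtain ⟨y, rfl⟩ := hl.exists_mul_levelGen hk
  rw [mem_sols, nrd_mul, nrd_levelGen hk] at hq
  exact ha ⟨_, by rw [← hq, mul_comm]⟩

/-- The number of elements of reduced norm `a` in the suborder. -/
noncomputable def subRep (a : ZSqrtTwo) : ℕ := {q ∈ sols a | 4 ∣ coordB q}.ncard

theorem ncard_sols_unitRep (a : ZSqrtTwo) (i : Fin 24) :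
    {q ∈ sols a | 4 ∣ coordB (unitRep i * q)}.ncard = subRep a := by
  have hc (p q : Cubian) (h : unitRep i * p = unitRep i * q) : p = q := by
    have := congrArg (conj (unitRep i) * ·) h
    simpa [← mul_assoc, conj_mul_self, nrd_unitRep] using this
  refine Set.ncard_congr (fun q _ => unitRep i * q) ?_ ?_ ?_
  · rintro q ⟨hq, h⟩
    exact ⟨by rw [mem_sols, nrd_mul, nrd_unitRep, one_mul, hq], h⟩
  · intro p q _ _ h
    exact hc p q h
  · rintro q ⟨hq, h⟩
    have h1 : unitRep i * (conj (unitRep i) * q) = q := by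
      rw [← mul_assoc, mul_conj, nrd_unitRep, map_one, one_mul]
    exact ⟨conj (unitRep i) * q, ⟨by rw [mem_sols, nrd_mul, nrd_conj, nrd_unitRep, one_mul, hq],
      by rwa [h1]⟩, h1⟩

/-- Double counting of the pairs `(q, u)` with `u * q` in the suborder: each of the 24 units
contributes `subRep a`, since left multiplication by a norm-one unit permutes the cubians of norm
`a`. -/
theorem subRep_mul (a : ZSqrtTwo) : 24 * subRep a = rep a + {q ∈ sols a | InLevel 1 q}.ncard
    + 2 * {q ∈ sols a | InLevel 2 q}.ncard + 4 * {q ∈ sols a | InLevel 3 q}.ncard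
    + 16 * {q ∈ sols a | InLevel 4 q}.ncard := by
  classical
  set S := (sols_finite a).toFinset with hS
  have hcard (P : Cubian → Prop) : {q ∈ sols a | P q}.ncard = (S.filter P).card := by
    rw [← Set.ncard_coe_finset]
    simp [hS]
  have h1 := Finset.sum_card_bipartiteAbove_eq_sum_card_bipartiteBelow
    (s := S) (t := (Finset.univ : Finset (Fin 24))) (fun q i => 4 ∣ coordB (unitRep i * q))
  simp only [Finset.bipartiteAbove, Finset.bipartiteBelow, ← hcard, ncard_sols_unitRep] at h1
  simp only [card_unitRep_filter] at h1
  simp only [Finset.sum_add_distrib, ← Finset.mul_sum, Finset.sum_boole, ← hcard] at h1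
  simp only [Finset.sum_const, smul_eq_mul, mul_one, Finset.card_univ, Fintype.card_fin, Nat.cast_id]
    at h1
  rw [← h1, rep, ← Set.ncard_coe_finset S]
  simp [hS]

end Cubian

/-! ### Identification with the number field and its quaternion algebra -/

/-- The map from `ℤ[√2]` to the ring of integers of `K`. -/
noncomputable def toInt : ZSqrtTwo →+* 𝓞 K :=
  Zsqrtd.lift ⟨sqrtTwo, by
    apply NumberField.RingOfIntegers.ext
    change sqrtTwoK * sqrtTwoK = algebraMap (𝓞 K) K ((2 : ℤ) : 𝓞 K)
    rw [← sq, sqrtTwoK_sq, map_intCast, Int.cast_ofNat]⟩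

theorem coe_toInt (r : ZSqrtTwo) : (toInt r : K) = r.re + r.im * sqrtTwoK := by
  simp [toInt, Zsqrtd.lift]

theorem toInt_rt : toInt rt = sqrtTwo := by
  apply NumberField.RingOfIntegers.ext
  rw [coe_toInt]
  simp

theorem coe_coe_toInt (r : ZSqrtTwo) : ((toInt r : K) : ℚ⟮(√2 : ℝ)⟯).1 = emb r := by
  rw [coe_toInt, emb_apply]
  rfl

theorem toInt_coe_injective : Function.Injective fun r => (toInt r : K) := by
  intro r r' h
  apply Zsqrtd.toReal_injective (by norm_num : (0 : ℤ) ≤ 2) two_ne_mul_self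
  have := congrArg (fun x : ℚ⟮(√2 : ℝ)⟯ => x.1) h
  rwa [coe_coe_toInt, coe_coe_toInt] at this

theorem toInt_injective : Function.Injective toInt := fun _ _ h =>
  toInt_coe_injective (congrArg (fun x : 𝓞 K => (x : K)) h)

theorem exists_eq_add_mul_sqrt_two {y : ℝ} (hy : y ∈ ℚ⟮(√2 : ℝ)⟯) :
    ∃ p q : ℚ, y = p + q * √2 := by
  have h2 : √2 * √2 = (2 : ℝ) := Real.mul_self_sqrt (by norm_num)
  induction hy using IntermediateField.adjoin_induction with
  | mem x hx => exact ⟨0, 1, by simpa using hx⟩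
  | algebraMap x => exact ⟨x, 0, by simp⟩
  | add x y _ _ hx hy =>
    obtain ⟨p, q, rfl⟩ := hx
    obtain ⟨p', q', rfl⟩ := hy
    exact ⟨p + p', q + q', by push_cast; ring⟩
  | mul x y _ _ hx hy =>
    obtain ⟨p, q, rfl⟩ := hx
    obtain ⟨p', q', rfl⟩ := hy
    refine ⟨p * p' + 2 * q * q', p * q' + q * p', ?_⟩
    push_cast
    linear_combination (q * q' : ℝ) * h2
  | inv x _ hx =>
    obtain ⟨p, q, rfl⟩ := hx
    by_cases h0 : p = 0 ∧ q = 0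
    · exact ⟨0, 0, by simp [h0.1, h0.2]⟩
    · have hn : p * p - 2 * q * q ≠ 0 := by
        intro h
        have hq : q ≠ 0 := by
          rintro rfl
          exact h0 ⟨by simpa using h, rfl⟩
        have h3 : IsSquare (2 : ℚ) := ⟨p / q, by field_simp; linarith⟩
        have h4 := Nat.Prime.irrational_sqrt Nat.prime_two
        rw [Nat.cast_ofNat, irrational_sqrt_ofNat_iff] at h4
        apply h4
        have := Rat.isSquare_natCast_iff (n := 2)
        exact this.1 (by exact_mod_cast h3)
      have hn' : (p * p - 2 * q * q : ℝ) ≠ 0 := by exact_mod_cast hn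
      refine ⟨p / (p * p - 2 * q * q), -q / (p * p - 2 * q * q), ?_⟩
      push_cast
      apply inv_eq_of_mul_eq_one_right
      have h5 : (p / (p * p - 2 * q * q) + -q / (p * p - 2 * q * q) * √2 : ℝ)
          = (p - q * √2) / (p * p - 2 * q * q) := by ring
      rw [h5, mul_div_assoc', div_eq_one_iff_eq hn']
      linear_combination (-(q : ℝ) * q) * h2

theorem exists_eq_div_toInt (x : K) : ∃ a b : ZSqrtTwo, b ≠ 0 ∧ x * toInt b = toInt a := by
  obtain ⟨p, q, h⟩ := exists_eq_add_mul_sqrt_two (y := (x : ℚ⟮(√2 : ℝ)⟯).1) x.2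
  have hx : x = p + q * sqrtTwoK := Subtype.ext (by rw [h]; rfl)
  refine ⟨⟨p.num * q.den, q.num * p.den⟩, ⟨p.den * q.den, 0⟩, ?_, ?_⟩
  · intro h
    have := congrArg Zsqrtd.re h
    simp at this
  · rw [coe_toInt, coe_toInt, hx]
    have hp : (p.den : K) ≠ 0 := by exact_mod_cast p.den_ne_zero
    have hq : (q.den : K) ≠ 0 := by exact_mod_cast q.den_ne_zero
    have hp' : (p : K) * p.den = p.num := by exact_mod_cast Rat.mul_den_eq_num p
    have hq' : (q : K) * q.den = q.num := by exact_mod_cast Rat.mul_den_eq_num q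
    push_cast
    linear_combination (q.den : K) * hp' + (p.den * sqrtTwoK : K) * hq'

noncomputable instance : Algebra ZSqrtTwo K := ((algebraMap (𝓞 K) K).comp toInt).toAlgebra

theorem algebraMap_zsqrtTwo (r : ZSqrtTwo) : algebraMap ZSqrtTwo K r = toInt r := rfl

instance : IsFractionRing ZSqrtTwo K := by
  have : FaithfulSMul ZSqrtTwo K := (faithfulSMul_iff_algebraMap_injective _ _).2 toInt_coe_injective
  refine IsFractionRing.of_field ZSqrtTwo K fun x => ?_
  obtain ⟨a, b, hb, h⟩ := exists_eq_div_toInt x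
  have hb' : (toInt b : K) ≠ 0 := fun h0 => hb (toInt_coe_injective (by simpa using h0))
  exact ⟨a, b, by rw [algebraMap_zsqrtTwo, algebraMap_zsqrtTwo, ← h, mul_div_cancel_right₀ _ hb']⟩

/-- `ℤ[√2]` is a principal ideal domain with fraction field `K`, hence integrally closed. -/
theorem toInt_surjective : Function.Surjective toInt := by
  intro x
  have h : IsIntegral ZSqrtTwo (x : K) := IsIntegral.tower_top x.2
  obtain ⟨r, hr⟩ := IsIntegrallyClosed.isIntegral_iff.1 h
  exact ⟨r, NumberField.RingOfIntegers.ext hr⟩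

/-- The ring of integers of `K` is `ℤ[√2]`. -/
noncomputable def intEquiv : ZSqrtTwo ≃+* 𝓞 K :=
  RingEquiv.ofBijective toInt ⟨toInt_injective, toInt_surjective⟩

theorem IsTotallyPositive.totPos {a : ZSqrtTwo} (h : IsTotallyPositive (toInt a)) : TotPos a := by
  have hi : Function.Injective emb := Zsqrtd.toReal_injective _ two_ne_mul_self
  have hi' : Function.Injective emb' := hi.comp star_injective
  constructor
  · have := h (IsFractionRing.lift hi)
    rwa [← algebraMap_zsqrtTwo, IsFractionRing.lift_algebraMap] at this
  · have := h (IsFractionRing.lift hi')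
    rwa [← algebraMap_zsqrtTwo, IsFractionRing.lift_algebraMap] at this

namespace Cubian

/-- The quaternion with given coordinates in the basis of the cubian order. -/
noncomputable def toQuat (x : Cubian) : ℍ[K] :=
  quat (toInt x.c0 + sqrtTwoK / 2 * toInt x.c1 + sqrtTwoK / 2 * toInt x.c2 + toInt x.c3 / 2)
    (sqrtTwoK / 2 * toInt x.c1 + toInt x.c3 / 2) (sqrtTwoK / 2 * toInt x.c2 + toInt x.c3 / 2)
    (toInt x.c3 / 2)

theorem coe_toInt_rt : (toInt rt : K) = sqrtTwoK := by rw [toInt_rt, coe_sqrtTwo]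

theorem normSq_toQuat (x : Cubian) : Quaternion.normSq (toQuat x) = toInt (nrd x) := by
  have hs := sqrtTwoK_sq
  have h := congrArg (fun r => (toInt r : K)) (four_mul_nrd x)
  simp only [map_mul, map_add, map_pow, map_ofNat, coe_toInt_rt] at h
  rw [Quaternion.normSq_def']
  simp only [toQuat, re_quat, imI_quat, imJ_quat, imK_quat]
  linear_combination (-1 / 4 : K) * h

theorem toQuat_injective : Function.Injective toQuat := by
  intro x y h
  have h0 := congrArg QuaternionAlgebra.re h
  have h1 := congrArg QuaternionAlgebra.imI h
  have h2 := congrArg QuaternionAlgebra.imJ h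
  have h3 := congrArg QuaternionAlgebra.imK h
  simp only [toQuat, re_quat, imI_quat, imJ_quat, imK_quat] at h0 h1 h2 h3
  have hs : sqrtTwoK / 2 ≠ 0 := by
    intro h
    have := sqrtTwoK_sq
    simp_all
  have e3 : (toInt x.c3 : K) = toInt y.c3 := by linear_combination 2 * h3
  have e1 : (toInt x.c1 : K) = toInt y.c1 := mul_left_cancel₀ hs (by linear_combination h1 - h3)
  have e2 : (toInt x.c2 : K) = toInt y.c2 := mul_left_cancel₀ hs (by linear_combination h2 - h3)
  have e0 : (toInt x.c0 : K) = toInt y.c0 := by linear_combination h0 - h1 - h2 + h3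
  exact Cubian.ext (toInt_coe_injective e0) (toInt_coe_injective e1) (toInt_coe_injective e2)
    (toInt_coe_injective e3)

/-- In cubian coordinates the basis of `orderG` leaves `c0`, `c2`, `c3` free and forces `c1 = 4g +
(1 + 2√2) c2 + (1 + √2) c3`, where `g` is the coefficient of `2√2 i`. -/
theorem mem_orderG {q : ℍ[K]} : q ∈ orderG ↔ ∃ x, 4 ∣ coordB x ∧ toQuat x = q := by
  have hs := sqrtTwoK_sq
  have h2 : (toInt 2 : K) = 2 := by
    rw [map_ofNat toInt 2]
    exact map_ofNat (algebraMap (𝓞 K) K) 2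
  have h4 : (toInt 4 : K) = 4 := by
    rw [map_ofNat toInt 4]
    exact map_ofNat (algebraMap (𝓞 K) K) 4
  constructor
  · rintro ⟨c, rfl⟩
    choose g hg using fun i => toInt_surjective (c i)
    refine ⟨⟨g 0 - 2 * rt * g 1 - (2 + rt) * g 2 - g 3,
      4 * g 1 + (1 + 2 * rt) * g 2 + (1 + rt) * g 3, g 2, g 3⟩, ⟨g 1, ?_⟩, ?_⟩
    · simp only [coordB]
      ring
    · simp only [← hg]
      ext <;> simp [toQuat, subBasis, Fin.sum_univ_four, Algebra.smul_def, inv_sqrtTwoK,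
        coe_toInt_rt, h2, h4] <;> grind
  · rintro ⟨⟨a, b, c, d⟩, ⟨g, hg⟩, rfl⟩
    simp only [coordB] at hg
    obtain rfl : b = 4 * g + (1 + 2 * rt) * c + (1 + rt) * d := by linear_combination hg
    refine ⟨fun i => toInt (![a + 2 * rt * g + (2 + rt) * c + d, g, c, d] i), ?_⟩
    ext <;> simp [toQuat, subBasis, Fin.sum_univ_four, Algebra.smul_def, inv_sqrtTwoK,
        coe_toInt_rt, h2, h4] <;> grind

theorem repCount_orderG (a : ZSqrtTwo) : repCount orderG (toInt a) = subRep a := by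
  have h : {q : ℍ[K] | q ∈ orderG ∧ Quaternion.normSq q = (toInt a : K)}
      = toQuat '' {x ∈ sols a | 4 ∣ coordB x} := by
    ext q
    simp only [mem_orderG, Set.mem_ofPred_eq, Set.mem_image, mem_sols]
    constructor
    · rintro ⟨⟨x, hx, rfl⟩, hn⟩
      rw [normSq_toQuat] at hn
      exact ⟨x, ⟨toInt_coe_injective hn, hx⟩, rfl⟩
    · rintro ⟨x, ⟨rfl, hx⟩, rfl⟩
      exact ⟨⟨x, hx, rfl⟩, normSq_toQuat x⟩
  rw [repCount, h, toQuat_injective.encard_image, subRep,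
    Set.Finite.cast_ncard_eq ((sols_finite a).subset fun _ h => h.1)]

end Cubian

/-! ### Recursions for the divisor sum -/

section IdealSum

/-- The divisors of the ideal `A` that are not divisible by `T`. -/
def primeToDivisors (T A : Ideal (𝓞 K)) : Set (Ideal (𝓞 K)) := {I | ¬ T ∣ I ∧ I ∣ A}

/-- The sum of the norms of the divisors of the ideal `A` that are not divisible by `T`. -/
noncomputable def primeToSum (T A : Ideal (𝓞 K)) : ℕ := ∑ᶠ I ∈ primeToDivisors T A, Ideal.absNorm I

variable {T A : Ideal (𝓞 K)}

theorem primeToDivisors_finite (hA : A ≠ 0) : (primeToDivisors T A).Finite := by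
  have : Finite {I // I ∣ A} := by
    have := UniqueFactorizationMonoid.fintypeSubtypeDvd A hA
    exact Finite.of_fintype _
  exact Set.Finite.subset (s := {I | I ∣ A}) this fun I hI => hI.2

theorem primeToSum_one (hT : Prime T) : primeToSum T 1 = 1 := by
  have : primeToDivisors T 1 = {1} := by
    ext I
    simp only [primeToDivisors, Set.mem_ofPred_eq, Set.mem_singleton_iff]
    refine ⟨fun h => by rw [Ideal.one_eq_top, ← Ideal.isUnit_iff]; exact isUnit_of_dvd_one h.2, ?_⟩
    rintro rfl
    exact ⟨fun h => hT.not_isUnit (isUnit_of_dvd_one h), dvd_rfl⟩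
  rw [primeToSum, this, finsum_mem_singleton, map_one]

theorem primeToSum_self_mul (hT : Prime T) : primeToSum T (T * A) = primeToSum T A := by
  have : primeToDivisors T (T * A) = primeToDivisors T A := by
    ext I
    simp only [primeToDivisors, Set.mem_ofPred_eq]
    refine and_congr_right fun h => ⟨fun hI => ?_, fun hI => hI.mul_left _⟩
    obtain ⟨J, hJ⟩ := hI
    obtain ⟨B, rfl⟩ := (hT.dvd_or_dvd (a := I) (b := J) ⟨A, hJ.symm⟩).resolve_left h
    refine ⟨B, mul_left_cancel₀ hT.ne_zero ?_⟩
    rw [hJ]; ring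
  rw [primeToSum, this, primeToSum]

variable {P : Ideal (𝓞 K)}

theorem image_mul_primeToDivisors (hT : Prime T) (hP : Prime P) (hTP : ¬ T ∣ P) :
    (P * ·) '' primeToDivisors T A = {I | I ∈ primeToDivisors T (P * A) ∧ P ∣ I} := by
  ext I
  constructor
  · rintro ⟨J, ⟨h1, h2⟩, rfl⟩
    exact ⟨⟨fun h => (hT.dvd_or_dvd h).elim hTP h1, mul_dvd_mul_left P h2⟩, dvd_mul_right _ _⟩
  · rintro ⟨⟨h1, h2⟩, J, rfl⟩
    exact ⟨J, ⟨fun h => h1 (h.mul_left _), (mul_dvd_mul_iff_left hP.ne_zero).1 h2⟩, rfl⟩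

theorem finsum_image_mul (hP : Prime P) :
    ∑ᶠ I ∈ (P * ·) '' primeToDivisors T A, Ideal.absNorm I
      = Ideal.absNorm P * primeToSum T A := by
  rw [finsum_mem_image (mul_right_injective₀ hP.ne_zero).injOn, primeToSum]
  simp only [map_mul]
  exact (mul_finsum_mem _ _).symm

theorem primeToDivisors_mul (hT : Prime T) (hP : Prime P) (hTP : ¬ T ∣ P) :
    primeToDivisors T (P * A) = primeToDivisors T A ∪ (P * ·) '' primeToDivisors T A := by
  rw [image_mul_primeToDivisors hT hP hTP]
  ext I
  constructor
  · rintro ⟨h1, h2⟩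
    by_cases h : P ∣ I
    · exact Or.inr ⟨⟨h1, h2⟩, h⟩
    · left
      refine ⟨h1, ?_⟩
      obtain ⟨J, hJ⟩ := h2
      obtain ⟨B, rfl⟩ := (hP.dvd_or_dvd (a := I) (b := J) ⟨A, hJ.symm⟩).resolve_left h
      refine ⟨B, mul_left_cancel₀ hP.ne_zero ?_⟩
      rw [hJ]; ring
  · rintro (h | h)
    · exact ⟨h.1, h.2.mul_left _⟩
    · exact h.1

theorem primeToSum_mul_of_not_dvd (hT : Prime T) (hP : Prime P) (hTP : ¬ T ∣ P) (hA : A ≠ 0)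
    (hPA : ¬ P ∣ A) : primeToSum T (P * A) = (Ideal.absNorm P + 1) * primeToSum T A := by
  have hd : Disjoint (primeToDivisors T A) ((P * ·) '' primeToDivisors T A) := by
    rw [Set.disjoint_left]
    rintro _ h1 ⟨J, -, rfl⟩
    exact hPA ((dvd_mul_right P J).trans h1.2)
  have hfin := primeToDivisors_finite (T := T) hA
  rw [primeToSum, primeToDivisors_mul hT hP hTP,
    finsum_mem_union hd hfin (hfin.image _), finsum_image_mul hP, ← primeToSum]
  ring

/-- The divisors of `P * (P * A)` are those of `P * A` together with their multiples by `P`; the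
overlap is `P` times the divisors of `A`. Inclusion and exclusion gives the same three-term relation
as `rep_mul_mul`. -/
theorem primeToSum_mul_mul (hT : Prime T) (hP : Prime P) (hTP : ¬ T ∣ P) (hA : A ≠ 0) :
    primeToSum T (P * (P * A)) + Ideal.absNorm P * primeToSum T A
      = (Ideal.absNorm P + 1) * primeToSum T (P * A) := by
  have hPA : P * A ≠ 0 := mul_ne_zero hP.ne_zero hA
  have hfin := primeToDivisors_finite (T := T) hPA
  have hi : primeToDivisors T (P * A) ∩ (P * ·) '' primeToDivisors T (P * A)
      = (P * ·) '' primeToDivisors T A := by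
    rw [image_mul_primeToDivisors hT hP hTP, image_mul_primeToDivisors hT hP hTP]
    ext I
    constructor
    · rintro ⟨h1, h2⟩
      exact ⟨h1, h2.2⟩
    · rintro ⟨h1, h2⟩
      exact ⟨h1, ⟨h1.1, h1.2.mul_left _⟩, h2⟩
  have h := finsum_mem_union_inter (f := fun I => Ideal.absNorm I) hfin (hfin.image (P * ·))
  rw [← primeToDivisors_mul hT hP hTP, hi, finsum_image_mul hP, finsum_image_mul hP,
    ← primeToSum, ← primeToSum] at h
  rw [h]
  ring

end IdealSum

/-! ### Primes of `ℤ[√2]`, their ideals and residue fields -/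

/-- The ideal generated by `√2`. -/
noncomputable def rtIdeal : Ideal (𝓞 K) := Ideal.span {sqrtTwo}

theorem oddDivisorSum_eq (α : 𝓞 K) : oddDivisorSum α = primeToSum rtIdeal (Ideal.span {α}) := rfl

theorem rt_mul_eq_rtPos : rt * (1 + rt) = Cubian.rtPos := by decide

theorem isUnit_one_add_rt : IsUnit (1 + rt) := IsUnit.of_mul_eq_one (-1 + rt) (by decide)

theorem rtPos_dvd_iff (a : ZSqrtTwo) : Cubian.rtPos ∣ a ↔ 2 ∣ a.re := by
  rw [← Cubian.rtPos_dvd, pow_one]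

theorem rtPos_prime : Prime Cubian.rtPos := by
  refine ⟨by decide, ?_, fun a b h => ?_⟩
  · intro h
    have := (rtPos_dvd_iff 1).1 h.dvd
    simp at this
  · rw [rtPos_dvd_iff, Zsqrtd.re_mul, mul_assoc 2, dvd_add_left (dvd_mul_right 2 _)] at h
    rw [rtPos_dvd_iff, rtPos_dvd_iff]
    exact Int.prime_two.dvd_or_dvd h

theorem totPos_rtPos : TotPos Cubian.rtPos := .of_re_pos_of_norm_pos (by decide) (by decide)

theorem rtIdeal_eq : rtIdeal = Ideal.span {toInt Cubian.rtPos} := by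
  rw [rtIdeal, ← toInt_rt, ← rt_mul_eq_rtPos, map_mul,
    Ideal.span_singleton_mul_right_unit (isUnit_one_add_rt.map toInt)]

theorem span_toInt_dvd {a b : ZSqrtTwo} :
    Ideal.span {toInt a} ∣ Ideal.span {toInt b} ↔ a ∣ b := by
  rw [Ideal.dvd_span_singleton, Ideal.mem_span_singleton]
  exact map_dvd_iff intEquiv

theorem prime_span_toInt {π : ZSqrtTwo} (hπ : Prime π) : Prime (Ideal.span {toInt π}) := by
  have h : Prime (toInt π) := (MulEquiv.prime_iff intEquiv).2 hπ
  rw [← Ideal.prime_span_singleton_iff] at h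
  exact h

theorem span_toInt_ne_zero {a : ZSqrtTwo} (ha : a ≠ 0) : Ideal.span {toInt a} ≠ 0 := by
  rw [Ideal.zero_eq_bot, Ne, Ideal.span_singleton_eq_bot]
  exact fun h => ha (toInt_injective (h.trans (map_zero _).symm))

theorem span_toInt_mul (a b : ZSqrtTwo) :
    Ideal.span {toInt (a * b)} = Ideal.span {toInt a} * Ideal.span {toInt b} := by
  rw [Ideal.span_singleton_mul_span_singleton, map_mul]

/-- Reduction modulo a prime of `ℤ[√2]`, as a map to a finite field. -/
theorem exists_residue_field {π : ZSqrtTwo} (hπ : Prime π) :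
    ∃ (F : Type) (_ : Field F) (_ : Fintype F) (f : ZSqrtTwo →+* F), Function.Surjective f ∧
      (∀ a, f a = 0 ↔ π ∣ a) ∧ Fintype.card F = Ideal.absNorm (Ideal.span {toInt π}) := by
  have hp : (Ideal.span {toInt π}).IsPrime :=
    (Ideal.prime_iff_isPrime (span_toInt_ne_zero hπ.ne_zero)).1 (prime_span_toInt hπ)
  have hm : (Ideal.span {toInt π}).IsMaximal := hp.isMaximal (span_toInt_ne_zero hπ.ne_zero)
  have hfin : Finite (𝓞 K ⧸ Ideal.span {toInt π}) :=
    Ideal.finiteQuotientOfFreeOfNeBot _ (span_toInt_ne_zero hπ.ne_zero)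
  have := Fintype.ofFinite (𝓞 K ⧸ Ideal.span {toInt π})
  refine ⟨_, Ideal.Quotient.field (Ideal.span {toInt π}), this,
    (Ideal.Quotient.mk _).comp toInt, ?_, fun a => ?_, ?_⟩
  · exact Ideal.Quotient.mk_surjective.comp toInt_surjective
  · rw [RingHom.comp_apply, Ideal.Quotient.eq_zero_iff_mem, ← Ideal.dvd_span_singleton]
    exact span_toInt_dvd
  · rw [Ideal.absNorm_apply, Submodule.cardQuot_apply, Nat.card_eq_fintype_card]

/-! ### Evaluation of the counts -/

namespace Cubian

/-- Induction on the norm, stripping off a totally positive prime factor: both sides satisfy the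
same Hecke relations. Totally positive units are squares, which reduces the base case to `rep_one`.
-/
theorem rep_of_not_dvd (n : ℕ) : ∀ b : ZSqrtTwo, TotPos b → ¬ rtPos ∣ b → b.norm.natAbs ≤ n →
    rep b = 48 * primeToSum rtIdeal (Ideal.span {toInt b}) := by
  have hT : Prime rtIdeal := by rw [rtIdeal_eq]; exact prime_span_toInt rtPos_prime
  induction n with
  | zero =>
    intro b hb _ hn
    have := hb.norm_pos
    omega
  | succ n ih =>
    intro b hb hodd hn
    by_cases hu : IsUnit b
    · obtain ⟨u, rfl⟩ := hb.isSquare_of_isUnit hu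
      have h1 := rep_unit_sq_mul u 1
      rw [mul_one] at h1
      rw [h1, rep_one, Ideal.span_singleton_eq_top.2 (hu.map toInt), ← Ideal.one_eq_top,
        primeToSum_one hT]
    · obtain ⟨p, hp, hpb⟩ := WfDvdMonoid.exists_irreducible_factor hu hb.ne_zero
      obtain ⟨π, hpπ, hpos⟩ := exists_totPos_associated p hp.ne_zero
      have hπ : Prime π := (hpπ.irreducible hp).prime
      obtain ⟨a, rfl⟩ := hpπ.dvd_iff_dvd_left.1 hpb
      have ha : TotPos a := hb.of_mul_left hpos
      have hTP : ¬ rtIdeal ∣ Ideal.span {toInt π} := by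
        rw [rtIdeal_eq, span_toInt_dvd]
        exact fun h => hodd (h.mul_right _)
      have hlt {c : ZSqrtTwo} (hc : TotPos c) : c.norm.natAbs < (π * c).norm.natAbs := by
        rw [Zsqrtd.norm_mul, Int.natAbs_mul]
        have h1 : (Zsqrtd.norm π).natAbs ≠ 1 := fun h =>
          hπ.not_isUnit (Zsqrtd.norm_eq_one_iff.1 h)
        have h2 := hpos.norm_pos
        have h3 := hc.norm_pos
        have h4 : 1 < (Zsqrtd.norm π).natAbs := by omega
        have h5 : 0 < (Zsqrtd.norm c).natAbs := by omega
        nlinarith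
      obtain ⟨F, _, _, f, hf, hker, hcard⟩ := exists_residue_field hπ
      have hodd' : ¬ rtPos ∣ a := fun h => hodd (h.mul_left _)
      have hla := hlt ha
      by_cases hda : π ∣ a
      · obtain ⟨c, rfl⟩ := hda
        have hc : TotPos c := ha.of_mul_left hpos
        have hlc := hlt hc
        have h1 := rep_mul_mul f hf hπ hker hpos c
        have h2 := primeToSum_mul_mul hT (prime_span_toInt hπ) hTP
          (span_toInt_ne_zero hc.ne_zero)
        rw [ih _ ha hodd' (by omega), ih _ hc (fun h => hodd' (h.mul_left _)) (by omega), hcard]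
          at h1
        simp only [span_toInt_mul] at h1 ⊢
        generalize Ideal.absNorm (Ideal.span {toInt π}) = N at *
        nlinarith
      · have h1 := rep_mul_of_not_dvd f hf hπ hker hpos hda
        rw [h1, hcard, ih _ ha hodd' (by omega), span_toInt_mul,
          primeToSum_mul_of_not_dvd hT (prime_span_toInt hπ) hTP (span_toInt_ne_zero ha.ne_zero)
            (by rwa [span_toInt_dvd])]
        ring

/-- Reduction modulo `√2`. -/
def modRt : ZSqrtTwo →+* ZMod 2 := Zsqrtd.lift ⟨0, by decide⟩

theorem modRt_eq_zero (a : ZSqrtTwo) : modRt a = 0 ↔ rtPos ∣ a := by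
  rw [rtPos_dvd_iff, modRt, Zsqrtd.lift_apply_apply]
  simp [ZMod.intCast_zmod_eq_zero_iff_dvd]

/-- The residue field at `√2` has two elements, so the recursion is `r (k + 2) + 2 r k = 3 r (k +
1)`, solved by `2 ^ (k + 1) - 1`. The additive form avoids subtraction of natural numbers. -/
theorem rep_rtPos_pow_mul {b : ZSqrtTwo} (hodd : ¬ rtPos ∣ b) (k : ℕ) :
    rep (rtPos ^ k * b) + rep b = 2 ^ (k + 1) * rep b := by
  have hf : Function.Surjective modRt := ZMod.ringHom_surjective modRt
  induction k using Nat.twoStepInduction with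
  | zero => simp; ring
  | one =>
    have := rep_mul_of_not_dvd modRt hf rtPos_prime modRt_eq_zero totPos_rtPos hodd
    rw [ZMod.card] at this
    rw [pow_one, this]
    ring
  | more k ih1 ih2 =>
    have := rep_mul_mul modRt hf rtPos_prime modRt_eq_zero totPos_rtPos (rtPos ^ k * b)
    rw [ZMod.card, ← mul_assoc rtPos (rtPos ^ k), ← pow_succ', ← mul_assoc, ← pow_succ'] at this
    have e1 : 2 ^ (k + 1) = 2 * 2 ^ k := by ring
    have e2 : 2 ^ (k + 1 + 1) = 4 * 2 ^ k := by ring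
    have e3 : 2 ^ (k + 2 + 1) = 8 * 2 ^ k := by ring
    rw [e1] at ih1
    rw [e2] at ih2
    rw [e3]
    change rep (rtPos ^ (k + 1 + 1) * b) + _ = _
    linarith

theorem primeToSum_rtPos_pow_mul (k : ℕ) (b : ZSqrtTwo) :
    primeToSum rtIdeal (Ideal.span {toInt (rtPos ^ k * b)})
      = primeToSum rtIdeal (Ideal.span {toInt b}) := by
  have hT : Prime rtIdeal := by rw [rtIdeal_eq]; exact prime_span_toInt rtPos_prime
  induction k with
  | zero => simp
  | succ k ih => rw [pow_succ', mul_assoc, span_toInt_mul, ← rtIdeal_eq, primeToSum_self_mul hT, ih]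

theorem valuationFactor_add_four (m : ℕ) : valuationFactor (m + 4) + 24 = 112 * 2 ^ m := by
  have h : ∑ i ∈ Finset.Icc 3 (m + 4), 2 ^ i + 8 = 2 ^ (m + 5) := by
    induction m with
    | zero => decide
    | succ m ih =>
      rw [show m + 1 + 4 = m + 5 by ring, Finset.sum_Icc_succ_top (by omega),
        show m + 1 + 5 = m + 5 + 1 by ring, pow_succ 2 (m + 5)]
      have h : 2 ^ (m + 5) = 2 * 2 ^ (m + 4) := by ring
      omega
  have h1 : valuationFactor (m + 4)
      = 2 * ∑ i ∈ Finset.Icc 3 (m + 4), 2 ^ i + 3 * 2 ^ (m + 4) - 2 ^ 3 := rfl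
  have h2 : 0 < 2 ^ m := by positivity
  have h3 : 2 ^ (m + 5) = 32 * 2 ^ m := by ring
  have h4 : 2 ^ (m + 4) = 16 * 2 ^ m := by ring
  omega

theorem subRep_rtPos_pow_mul {b : ZSqrtTwo} (hb : TotPos b) (hodd : ¬ rtPos ∣ b) (e : ℕ) :
    subRep (rtPos ^ e * b)
      = 2 * primeToSum rtIdeal (Ideal.span {toInt b}) * valuationFactor e := by
  have h0 := rep_of_not_dvd _ b hb hodd le_rfl
  set g := primeToSum rtIdeal (Ideal.span {toInt b})
  have hr (k : ℕ) : rep (rtPos ^ k * b) + 48 * g = 2 ^ (k + 1) * (48 * g) := by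
    rw [← h0, rep_rtPos_pow_mul hodd]
  have hsub := subRep_mul (rtPos ^ e * b)
  -- The level `k` term is `rep` at exponent `e - k` when `k ≤ e`, and vanishes otherwise. This
  -- truncation produces the separate cases `e < 4`.
  have hlevel {k : ℕ} (hk : k ≤ 4) (m : ℕ) (he : e = k + m) :
      {q ∈ sols (rtPos ^ e * b) | InLevel k q}.ncard = rep (rtPos ^ m * b) := by
    rw [he, pow_add, mul_assoc, ncard_sols_inLevel hk]
  have hzero {k : ℕ} (hk : k ≤ 4) (he : e < k) :
      {q ∈ sols (rtPos ^ e * b) | InLevel k q}.ncard = 0 := by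
    refine ncard_sols_inLevel_of_not_dvd hk fun h => hodd ?_
    have h1 := (pow_dvd_pow rtPos (show e + 1 ≤ k from he)).trans h
    rw [pow_succ] at h1
    exact (mul_dvd_mul_iff_left (pow_ne_zero e rtPos_prime.ne_zero)).1 h1
  have r0 := hr 0
  have r1 := hr 1
  have r2 := hr 2
  have r3 := hr 3
  obtain rfl | rfl | rfl | rfl | he : e = 0 ∨ e = 1 ∨ e = 2 ∨ e = 3 ∨ 4 ≤ e := by omega
  · rw [hzero (k := 1) (by simp) (by simp), hzero (k := 2) (by simp) (by simp),
      hzero (k := 3) (by simp) (by simp), hzero (k := 4) (by simp) (by simp)] at hsub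
    simp only [valuationFactor]
    omega
  · rw [hlevel (k := 1) (by simp) 0 rfl, hzero (k := 2) (by simp) (by simp),
      hzero (k := 3) (by simp) (by simp), hzero (k := 4) (by simp) (by simp)] at hsub
    simp only [valuationFactor]
    omega
  · rw [hlevel (k := 1) (by simp) 1 rfl, hlevel (k := 2) (by simp) 0 rfl,
      hzero (k := 3) (by simp) (by simp), hzero (k := 4) (by simp) (by simp)] at hsub
    simp only [valuationFactor]
    omega
  · rw [hlevel (k := 1) (by simp) 2 rfl, hlevel (k := 2) (by simp) 1 rfl,
      hlevel (k := 3) (by simp) 0 rfl, hzero (k := 4) (by simp) (by simp)] at hsub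
    simp only [valuationFactor]
    omega
  · obtain ⟨m, rfl⟩ := Nat.exists_eq_add_of_le' he
    rw [hlevel (k := 1) (by simp) (m + 3) (by ring), hlevel (k := 2) (by simp) (m + 2) (by ring),
      hlevel (k := 3) (by simp) (m + 1) (by ring), hlevel (k := 4) (by simp) m (by ring)] at hsub
    have s0 := hr m
    have s1 := hr (m + 1)
    have s2 := hr (m + 2)
    have s3 := hr (m + 3)
    have s4 := hr (m + 4)
    -- For `e = m + 4` the five terms add up to `48 g (7 * 2 ^ e - 24)`, and `7 * 2 ^ e = 112 * 2 ^
    -- m`.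
    have hv := congrArg (g * ·) (valuationFactor_add_four m)
    rw [pow_succ] at s0
    rw [show 2 ^ (m + 1 + 1) = 4 * 2 ^ m by ring] at s1
    rw [show 2 ^ (m + 2 + 1) = 8 * 2 ^ m by ring] at s2
    rw [show 2 ^ (m + 3 + 1) = 16 * 2 ^ m by ring] at s3
    rw [show 2 ^ (m + 4 + 1) = 32 * 2 ^ m by ring] at s4
    linarith

end Cubian

end SqrtTwoQuaternion

theorem mainTheorem12 (α : 𝓞 SqrtTwoQuaternion.K) (hα : SqrtTwoQuaternion.IsTotallyPositive α)
    (e : ℕ) (he : α ∈ Ideal.span {SqrtTwoQuaternion.sqrtTwo} ^ e)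
    (he' : α ∉ Ideal.span {SqrtTwoQuaternion.sqrtTwo} ^ (e + 1)) :
    SqrtTwoQuaternion.repCount SqrtTwoQuaternion.orderG α =
      ((2 * SqrtTwoQuaternion.oddDivisorSum α * SqrtTwoQuaternion.valuationFactor e : ℕ) : ℕ∞) := by
  open SqrtTwoQuaternion Cubian in
  obtain ⟨a, rfl⟩ := toInt_surjective α
  have hpow (k : ℕ) : toInt a ∈ Ideal.span {sqrtTwo} ^ k ↔ rtPos ^ k ∣ a := by
    rw [← rtIdeal, rtIdeal_eq, Ideal.span_singleton_pow, ← map_pow, ← Ideal.dvd_span_singleton,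
      span_toInt_dvd]
  rw [hpow] at he he'
  obtain ⟨b, rfl⟩ := he
  have hodd : ¬ rtPos ∣ b := fun h => he' (by rw [pow_succ]; exact mul_dvd_mul_left _ h)
  have hb : TotPos b := hα.totPos.of_mul_left (totPos_rtPos.pow e)
  rw [repCount_orderG, subRep_rtPos_pow_mul hb hodd, oddDivisorSum_eq, primeToSum_rtPos_pow_mul]
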